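/- Consider finite simple undirected graphs whose vertices are colored (each vertex has exactly one color, from an arbitrary color set), as structures with equality, the adjacency relation and one unary predicate for each color. Let $\mathrm{FO}^k$ be the set of first-order formulas, in negation normal form, that use at most $k$ distinct variables (which may be re-quantified). A sentence distinguishes $G$ from $H$ if it is true on $G$ and false on $H$. Let $D^k(G,H)$ and $A^k(G,H)$ be the minimum quantifier depth and the minimum alternation depth (the maximum length of a sequence of nested alternating quantifiers) of an $\mathrm{FO}^k$ sentence distinguishing $G$ from $H$; both are $\infty$ if there is no such sentence. Over colored trees, let $A^k(n)$ be the maximum of $A^k(T,T')$ over all pairs of colored trees $T,T'$ with $n$ vertices each that are distinguishable in $\mathrm{FO}^k$. **Theorem 3.** Let $k\ge 3$. 1. Let $T$ and $T'$ be colored trees, let $n\ge 2$ be the number of vertices of $T$ (the number of vertices of $T'$ is arbitrary), and suppose that $D^k(T,T')<\infty$. Then $D^k(T,T')<(k+3)\log_2 n$. 2. Consequently, over colored trees, $A^k(n)<(k+3)\log_2 n$ for every $n\ge 2$; in particular, $A^k(n)=O(\log n)$ as $n\to\infty$. -/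

import Mathlib

universe u v w

/-- A (vertex-)colored graph: a simple undirected graph on `V` together with a color from `C`
for every vertex. -/
structure ColoredGraph (C : Type*) (V : Type*) where
  graph : SimpleGraph V
  color : V → C

/-- A colored graph whose underlying graph is a tree (nonempty, connected, acyclic). -/
def ColoredGraph.IsTree {C V : Type*} (T : ColoredGraph C V) : Prop := T.graph.IsTree

/-- First-order formulas in negation normal form over the vocabulary of graphs with vertex colors
from `C` (equality, adjacency, and a unary predicate for every color), in which only the `k`
variables `x i`, `i : Fin k`, occur. A variable may be quantified repeatedly. -/
inductive FOk (C : Type*) (k : ℕ) where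
  | eq (i j : Fin k)
  | ne (i j : Fin k)
  | adj (i j : Fin k)
  | nadj (i j : Fin k)
  | col (c : C) (i : Fin k)
  | ncol (c : C) (i : Fin k)
  | and (φ ψ : FOk C k)
  | or (φ ψ : FOk C k)
  | ex (i : Fin k) (φ : FOk C k)
  | all (i : Fin k) (φ : FOk C k)

namespace FOk

variable {C V : Type*} {k : ℕ}

/-- Tarskian satisfaction in a colored graph under an assignment of the `k` variables. -/
def Sat (G : ColoredGraph C V) : FOk C k → (Fin k → V) → Prop
  | eq i j, a => a i = a j
  | ne i j, a => ¬ a i = a j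
  | adj i j, a => G.graph.Adj (a i) (a j)
  | nadj i j, a => ¬ G.graph.Adj (a i) (a j)
  | col c i, a => G.color (a i) = c
  | ncol c i, a => ¬ G.color (a i) = c
  | and φ ψ, a => Sat G φ a ∧ Sat G ψ a
  | or φ ψ, a => Sat G φ a ∨ Sat G ψ a
  | ex i φ, a => ∃ v : V, Sat G φ (Function.update a i v)
  | all i φ, a => ∀ v : V, Sat G φ (Function.update a i v)

/-- The variables that occur free. -/
def freeVars : FOk C k → Finset (Fin k)
  | eq i j => {i, j}
  | ne i j => {i, j}
  | adj i j => {i, j}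
  | nadj i j => {i, j}
  | col _ i => {i}
  | ncol _ i => {i}
  | and φ ψ => freeVars φ ∪ freeVars ψ
  | or φ ψ => freeVars φ ∪ freeVars ψ
  | ex i φ => (freeVars φ).erase i
  | all i φ => (freeVars φ).erase i

/-- Quantifier depth. -/
def quantDepth : FOk C k → ℕ
  | and φ ψ => max (quantDepth φ) (quantDepth ψ)
  | or φ ψ => max (quantDepth φ) (quantDepth ψ)
  | ex _ φ => quantDepth φ + 1
  | all _ φ => quantDepth φ + 1
  | _ => 0

/-- `altFrom true φ` (`altFrom false φ`) is the maximum length of a sequence of nested quantifiers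
in `φ` that starts with `∃` (with `∀`) and in which `∃` and `∀` alternate. -/
def altFrom : Bool → FOk C k → ℕ
  | b, and φ ψ => max (altFrom b φ) (altFrom b ψ)
  | b, or φ ψ => max (altFrom b φ) (altFrom b ψ)
  | true, ex _ φ => max (altFrom true φ) (altFrom false φ + 1)
  | false, ex _ φ => altFrom false φ
  | true, all _ φ => altFrom true φ
  | false, all _ φ => max (altFrom false φ) (altFrom true φ + 1)
  | _, _ => 0

/-- Alternation depth: the maximum length of a sequence of nested alternating quantifiers. -/
def altDepth (φ : FOk C k) : ℕ := max (altFrom true φ) (altFrom false φ)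

/-- A formula without free variables. -/
def IsSentence (φ : FOk C k) : Prop := φ.freeVars = ∅

/-- Truth of a sentence in a colored graph. -/
def TrueOn (φ : FOk C k) (G : ColoredGraph C V) : Prop := ∀ a : Fin k → V, φ.Sat G a

/-- The sentence `φ` distinguishes `G` from `H`: it is true on `G` and false on `H`. -/
def Distinguishes {W : Type*} (φ : FOk C k) (G : ColoredGraph C V) (H : ColoredGraph C W) : Prop :=
  φ.IsSentence ∧ φ.TrueOn G ∧ ¬ φ.TrueOn H

end FOk

/-- `D^k(G, H)`: the minimum quantifier depth of a `k`-variable sentence that distinguishes `G`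
from `H`, and `⊤` if there is none. -/
noncomputable def distDepth (k : ℕ) {C V W : Type*}
    (G : ColoredGraph C V) (H : ColoredGraph C W) : ℕ∞ :=
  ⨅ (φ : FOk C k) (_ : φ.Distinguishes G H), (φ.quantDepth : ℕ∞)

/-- `A^k(G, H)`: the minimum alternation depth of a `k`-variable sentence that distinguishes `G`
from `H`, and `⊤` if there is none. -/
noncomputable def distAlt (k : ℕ) {C V W : Type*}
    (G : ColoredGraph C V) (H : ColoredGraph C W) : ℕ∞ :=
  ⨅ (φ : FOk C k) (_ : φ.Distinguishes G H), (φ.altDepth : ℕ∞)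

/-- The alternation function `A^k(n)` over colored trees: the largest value of `A^k(T, T')` over
all pairs of colored trees `T`, `T'` with `n` vertices each (and with any set of colors) that are
distinguishable in `k`-variable logic. -/
noncomputable def treeAltFun (k n : ℕ) : ℕ∞ :=
  sSup {a : ℕ∞ | ∃ (C : Type u) (V : Type v) (W : Type w)
    (T : ColoredGraph C V) (T' : ColoredGraph C W),
    Finite V ∧ Finite W ∧ Nat.card V = n ∧ Nat.card W = n ∧ T.IsTree ∧ T'.IsTree ∧
    (∃ φ : FOk C k, φ.Distinguishes T T') ∧ a = distAlt k T T'}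

/-! Alternation depth is at most quantifier depth, so it suffices to bound quantifier depth. A win
for Spoiler in `r` rounds of the `k`-pebble game gives a distinguishing sentence of depth at most
`r`; `Wins` expresses this game through formulas.

The invariant is the type of a branch (`branchType`): its rooted isomorphism type, with the
multiplicity of equal types among the children of each vertex capped at `k`. If some rootings of the
two trees have equal types, Duplicator never loses. She maintains a type-preserving embedding of the
pebbled vertices and their ancestors. While a pebble is being moved, fewer than `k` children of any
vertex are occupied, so capped counts are all she needs (`not_distinguishes`). Thus for
distinguishable trees no rooted type of one occurs in the other, and Spoiler relies on this.

Spoiler starts at a centroid and reaches, by counting neighbors of a suitable type, two branches of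
different types, one of which has type size at most half of `n` (`wins_nil`). Such a position with a
type of size `m` is won in `(k + 3) * log m + 1` rounds, by induction on `m` (`branchWins`). Only
the size of one of the two types matters, which is why the second tree may be arbitrarily large.
Spoiler pebbles a deepest vertex `c` whose type has size above `m / 2`. Either the types at `c`
differ, and all children of `c` are small, or the types change somewhere on the path to `c`. That
place is found by a binary search that halves differences of type sizes rather than distances
(`wins_of_segment`).

At the vertex where the types change, Spoiler pebbles more children of a critical type than
Duplicator can match (`wins_of_branchType_ne_at`). The difficulty is to do so with `k` pebbles: the
vertex itself is recovered from two of its neighbors (`wins_of_neighbors`), and the one case in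
which the pebble on the parent cannot be spared is excluded by comparing rooted types
(`exists_type_of_ne`). -/

/-! ### Negation, free variables and conjunctions of formulas -/

namespace FOk

variable {C V : Type*} {k : ℕ}

/-- The negation of a formula, in negation normal form. -/
def neg : FOk C k → FOk C k
  | eq i j => ne i j
  | ne i j => eq i j
  | adj i j => nadj i j
  | nadj i j => adj i j
  | col c i => ncol c i
  | ncol c i => col c i
  | and φ ψ => or (neg φ) (neg ψ)
  | or φ ψ => and (neg φ) (neg ψ)
  | ex i φ => all i (neg φ)
  | all i φ => ex i (neg φ)

theorem quantDepth_neg (φ : FOk C k) : φ.neg.quantDepth = φ.quantDepth := by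
  induction φ <;> simp_all [neg, quantDepth]

theorem freeVars_neg (φ : FOk C k) : φ.neg.freeVars = φ.freeVars := by
  induction φ <;> simp_all [neg, freeVars]

theorem sat_neg (G : ColoredGraph C V) (φ : FOk C k) (a : Fin k → V) :
    φ.neg.Sat G a ↔ ¬ φ.Sat G a := by
  induction φ generalizing a <;> simp_all [neg, Sat, imp_iff_not_or]

theorem sat_congr (G : ColoredGraph C V) (φ : FOk C k) {a b : Fin k → V}
    (h : ∀ i ∈ φ.freeVars, a i = b i) : φ.Sat G a ↔ φ.Sat G b := by
  induction φ generalizing a b with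
  | and φ ψ h1 h2 =>
    simp only [freeVars, Finset.mem_union] at h
    simp only [Sat, h1 fun i hi => h i (Or.inl hi), h2 fun i hi => h i (Or.inr hi)]
  | or φ ψ h1 h2 =>
    simp only [freeVars, Finset.mem_union] at h
    simp only [Sat, h1 fun i hi => h i (Or.inl hi), h2 fun i hi => h i (Or.inr hi)]
  | ex i φ ih =>
    simp only [Sat]
    refine exists_congr fun v => ih fun j hj => ?_
    by_cases hji : j = i
    · subst hji; simp
    · simpa [Function.update_of_ne hji] using h j (by simp [freeVars, hji, hj])
  | all i φ ih =>
    simp only [Sat]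
    refine forall_congr' fun v => ih fun j hj => ?_
    by_cases hji : j = i
    · subst hji; simp
    · simpa [Function.update_of_ne hji] using h j (by simp [freeVars, hji, hj])
  | _ => simp_all [Sat, freeVars]

theorem altFrom_le_quantDepth (φ : FOk C k) (b : Bool) : φ.altFrom b ≤ φ.quantDepth := by
  induction φ generalizing b with
  | and φ ψ h1 h2 => cases b <;> exact max_le_max (h1 _) (h2 _)
  | or φ ψ h1 h2 => cases b <;> exact max_le_max (h1 _) (h2 _)
  | ex i φ ih =>
    cases b
    · exact (ih false).trans (Nat.le_succ _)
    · exact max_le ((ih true).trans (Nat.le_succ _)) (Nat.succ_le_succ (ih false))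
  | all i φ ih =>
    cases b
    · exact max_le ((ih false).trans (Nat.le_succ _)) (Nat.succ_le_succ (ih true))
    · exact (ih true).trans (Nat.le_succ _)
  | _ => cases b <;> simp [altFrom, quantDepth]

theorem altDepth_le_quantDepth (φ : FOk C k) : φ.altDepth ≤ φ.quantDepth :=
  max_le (φ.altFrom_le_quantDepth true) (φ.altFrom_le_quantDepth false)

/-- Conjunction of a nonempty finite family of formulas. -/
theorem exists_conj {W ι : Type*} (s : Finset ι) (hs : s.Nonempty) (f : ι → FOk C k)
    (G : ColoredGraph C V) (H : ColoredGraph C W) (r : ℕ) (S : Finset (Fin k))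
    (hd : ∀ i ∈ s, (f i).quantDepth ≤ r) (hv : ∀ i ∈ s, (f i).freeVars ⊆ S) :
    ∃ φ : FOk C k, φ.quantDepth ≤ r ∧ φ.freeVars ⊆ S ∧
      (∀ a, φ.Sat G a ↔ ∀ i ∈ s, (f i).Sat G a) ∧ ∀ a, φ.Sat H a ↔ ∀ i ∈ s, (f i).Sat H a := by
  induction hs using Finset.Nonempty.cons_induction with
  | singleton i => exact ⟨f i, hd i (by simp), hv i (by simp), by simp, by simp⟩
  | cons i s his hs ih =>
    obtain ⟨φ, h1, h2, h3, h4⟩ := ih (fun j hj => hd j (by simp [hj])) fun j hj => hv j (by simp [hj])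
    refine ⟨.and (f i) φ, max_le (hd i (by simp)) h1, Finset.union_subset (hv i (by simp)) h2, ?_, ?_⟩
    · intro a; simp [Sat, h3]
    · intro a; simp [Sat, h4]

end FOk

theorem distAlt_le_distDepth (k : ℕ) {C V W : Type*} (G : ColoredGraph C V)
    (H : ColoredGraph C W) : distAlt k G H ≤ distDepth k G H :=
  iInf_mono fun φ => iInf_mono fun _ => by exact_mod_cast φ.altDepth_le_quantDepth

/-! ### The pebble game -/

/-- Spoiler wins the `r`-round `k`-pebble game on `G` and `H` from the position in which the pairs
of `L` are pebbled, stated in terms of formulas: under all assignments that extend the position,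
some formula of quantifier depth at most `r` about the pebbled vertices holds in `G` only. -/
def Wins (k : ℕ) {C V W : Type*} (G : ColoredGraph C V) (H : ColoredGraph C W) (r : ℕ)
    (L : List (V × W)) : Prop :=
  ∀ (p : Fin k → V) (q : Fin k → W) (S : Finset (Fin k)), (∀ x ∈ L, ∃ i ∈ S, (p i, q i) = x) →
    ∃ φ : FOk C k, φ.quantDepth ≤ r ∧ φ.freeVars ⊆ S ∧ φ.Sat G p ∧ ¬ φ.Sat H q

namespace Wins

variable {k : ℕ} {C V W : Type*} {G : ColoredGraph C V} {H : ColoredGraph C W} {r s : ℕ}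
  {L M : List (V × W)}

theorem mono (h : Wins k G H r L) (hrs : r ≤ s) (hLM : L ⊆ M) : Wins k G H s M := by
  intro p q S hS
  obtain ⟨φ, h1, h2⟩ := h p q S fun x hx => hS x (hLM hx)
  exact ⟨φ, h1.trans hrs, h2⟩

/-- Negating the formula exchanges the roles of the graphs, so Spoiler may move in either of them.
-/
theorem swap (h : Wins k G H r L) : Wins k H G r (L.map Prod.swap) := by
  intro p q S hS
  obtain ⟨φ, h1, h2, h3, h4⟩ := h q p S fun x hx => by
    obtain ⟨i, hi, hpq⟩ := hS x.swap (List.mem_map_of_mem hx)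
    exact ⟨i, hi, by rw [← Prod.swap_inj, ← hpq]; rfl⟩
  exact ⟨φ.neg, by rwa [FOk.quantDepth_neg], by rwa [FOk.freeVars_neg], by rwa [FOk.sat_neg],
    by rwa [FOk.sat_neg, not_not]⟩

theorem of_swap (h : Wins k H G r (L.map Prod.swap)) : Wins k G H r L := by
  simpa using h.swap

theorem of_pair {x y : V} {x' y' : W} (hx : (x, x') ∈ L) (hy : (y, y') ∈ L)
    (h : ∀ i j : Fin k, ∃ φ : FOk C k, φ.quantDepth = 0 ∧ φ.freeVars ⊆ {i, j} ∧
      ∀ (p : Fin k → V) (q : Fin k → W), p i = x → p j = y → q i = x' → q j = y' →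
        φ.Sat G p ∧ ¬ φ.Sat H q) : Wins k G H r L := by
  intro p q S hS
  obtain ⟨i, hi, hi'⟩ := hS _ hx
  obtain ⟨j, hj, hj'⟩ := hS _ hy
  obtain ⟨φ, h1, h2, h3⟩ := h i j
  simp only [Prod.mk.injEq] at hi' hj'
  exact ⟨φ, by simp [h1], h2.trans (by simp [Finset.insert_subset_iff, hi, hj]),
    h3 p q hi'.1 hj'.1 hi'.2 hj'.2⟩

theorem of_eq {x y : V} {x' y' : W} (hx : (x, x') ∈ L) (hy : (y, y') ∈ L)
    (h : ¬ (x = y ↔ x' = y')) : Wins k G H r L := by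
  refine of_pair hx hy fun i j => ?_
  by_cases hxy : x = y
  · exact ⟨.eq i j, rfl, subset_rfl, fun p q h1 h2 h3 h4 => by simp_all [FOk.Sat]⟩
  · exact ⟨.ne i j, rfl, subset_rfl, fun p q h1 h2 h3 h4 => by simp_all [FOk.Sat]⟩

theorem of_adj {x y : V} {x' y' : W} (hx : (x, x') ∈ L) (hy : (y, y') ∈ L)
    (h : ¬ (G.graph.Adj x y ↔ H.graph.Adj x' y')) : Wins k G H r L := by
  refine of_pair hx hy fun i j => ?_
  by_cases hxy : G.graph.Adj x y
  · exact ⟨.adj i j, rfl, subset_rfl, fun p q h1 h2 h3 h4 => by simp_all [FOk.Sat]⟩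
  · exact ⟨.nadj i j, rfl, subset_rfl, fun p q h1 h2 h3 h4 => by simp_all [FOk.Sat]⟩

theorem of_color {x : V} {x' : W} (hx : (x, x') ∈ L) (h : G.color x ≠ H.color x') :
    Wins k G H r L :=
  of_pair hx hx fun i _ => ⟨.col (G.color x) i, rfl, by simp [FOk.freeVars],
    fun p q h1 _ h3 _ => ⟨by simp [FOk.Sat, h1], by simp [FOk.Sat, h3, h.symm]⟩⟩

/-- A round is an existential quantifier in front of the conjunction of the formulas for
Duplicator's finitely many answers. -/
theorem step [Finite W] [Nonempty W] (hL : L.length < k) (x : V)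
    (h : ∀ x', Wins k G H r ((x, x') :: L)) : Wins k G H (r + 1) L := by
  classical
  intro p q S hS
  have : Nonempty (Fin k) := ⟨⟨_, hL⟩⟩
  choose! g hg using hS
  -- Only the variables that carry pairs of `L` must be kept; there are fewer than `k` of them, so
  -- some variable can be requantified.
  let S₀ := (L.map g).toFinset
  have hS₀ : S₀ ⊆ S := by
    intro i hi
    simp only [S₀, List.mem_toFinset, List.mem_map] at hi
    obtain ⟨y, hy, rfl⟩ := hi
    exact (hg y hy).1
  have hcard : S₀.card < (Finset.univ : Finset (Fin k)).card := by
    simpa using (List.toFinset_card_le _).trans_lt (by simpa using hL)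
  obtain ⟨i, -, hi⟩ := Finset.exists_mem_notMem_of_card_lt_card hcard
  have key : ∀ x', ∃ φ : FOk C k, φ.quantDepth ≤ r ∧ φ.freeVars ⊆ insert i S₀ ∧
      φ.Sat G (Function.update p i x) ∧ ¬ φ.Sat H (Function.update q i x') := by
    intro x'
    refine h x' _ _ _ fun y hy => ?_
    rcases List.mem_cons.1 hy with rfl | hy
    · exact ⟨i, by simp, by simp⟩
    · have hgi : g y ∈ S₀ := by simp only [S₀, List.mem_toFinset]; exact List.mem_map_of_mem hy
      have : g y ≠ i := fun e => hi (e ▸ hgi)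
      exact ⟨g y, by simp [hgi], by simpa [Function.update_of_ne this] using (hg y hy).2⟩
  choose f hf using key
  have := Fintype.ofFinite W
  obtain ⟨φ, h1, h2, h3, h4⟩ := FOk.exists_conj Finset.univ Finset.univ_nonempty f G H r
    (insert i S₀) (fun x' _ => (hf x').1) (fun x' _ => (hf x').2.1)
  refine ⟨.ex i φ, Nat.succ_le_succ h1, ?_, ⟨x, ?_⟩, ?_⟩
  · intro j hj
    simp only [FOk.freeVars, Finset.mem_erase] at hj
    exact hS₀ ((Finset.mem_insert.1 (h2 hj.2)).resolve_left hj.1)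
  · rw [h3]; exact fun x' _ => (hf x').2.2.1
  · rintro ⟨x', hx'⟩
    rw [h4] at hx'
    exact (hf x').2.2.2 (hx' x' (Finset.mem_univ _))

theorem step' [Finite V] [Nonempty V] (hL : L.length < k) (x' : W)
    (h : ∀ x, Wins k G H r ((x, x') :: L)) : Wins k G H (r + 1) L :=
  of_swap <| step (by simpa using hL) x' fun x => (h x).swap

theorem distDepth_le [Nonempty V] [Nonempty W] (h : Wins k G H r []) :
    distDepth k G H ≤ r := by
  obtain ⟨φ, h1, h2, h3, h4⟩ := h (fun _ => Classical.arbitrary V) (fun _ => Classical.arbitrary W)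
    ∅ (by simp)
  have h0 : φ.freeVars = ∅ := Finset.subset_empty.1 h2
  refine iInf₂_le_of_le φ ⟨h0, fun a => ?_, fun h => h4 (h _)⟩ (by exact_mod_cast h1)
  exact (FOk.sat_congr G φ (by simp [h0])).1 h3

end Wins

/-! ### Distances and parents in trees -/

namespace SimpleGraph

variable {V : Type*} {G : SimpleGraph V} {a b c t w x y z : V}

open Classical in
/-- The neighbor of `w` on the way to `a` (and `w` itself if `w = a`). -/
noncomputable def par (G : SimpleGraph V) (a w : V) : V :=
  if h : ∃ b, G.Adj b w ∧ G.dist a b + 1 = G.dist a w then h.choose else w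

theorem par_self : G.par a a = a := by
  rw [par, dif_neg]; simp

namespace IsTree

/-- Shortest walks to `b` and to `c`, extended by the edge to `w`, are both the unique path from `a`
to `w`. -/
theorem eq_of_dist (hG : G.IsTree) (hb : G.Adj b w) (hc : G.Adj c w)
    (h1 : G.dist a b + 1 = G.dist a w) (h2 : G.dist a c + 1 = G.dist a w) : b = c := by
  obtain ⟨p, hp⟩ := hG.connected.exists_walk_length_eq_dist a b
  obtain ⟨q, hq⟩ := hG.connected.exists_walk_length_eq_dist a c
  have hp' : (p.concat hb).IsPath := Walk.isPath_of_length_eq_dist _ (by simp [hp, h1])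
  have hq' : (q.concat hc).IsPath := Walk.isPath_of_length_eq_dist _ (by simp [hq, h2])
  have := (hG.existsUnique_path a w).unique hp' hq'
  simpa using congrArg Walk.penultimate this

theorem exists_adj_dist (hG : G.IsTree) (h : a ≠ w) :
    ∃ b, G.Adj b w ∧ G.dist a b + 1 = G.dist a w := by
  obtain ⟨p, hp⟩ := hG.connected.exists_walk_length_eq_dist a w
  have hn : ¬ p.Nil := Walk.not_nil_of_ne h
  have hadj := p.adj_penultimate hn
  refine ⟨p.penultimate, hadj, ?_⟩
  have h1 : G.dist a p.penultimate ≤ p.dropLast.length := dist_le _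
  have h2 : p.dropLast.length + 1 = p.length := by
    have := congrArg Walk.length (p.concat_dropLast hadj)
    rwa [Walk.length_concat] at this
  have h3 := hG.connected.dist_triangle (u := a) (v := p.penultimate) (w := w)
  rw [dist_eq_one_iff_adj.2 hadj] at h3
  omega

theorem par_spec (hG : G.IsTree) (h : a ≠ w) :
    G.Adj (G.par a w) w ∧ G.dist a (G.par a w) + 1 = G.dist a w := by
  have h := hG.exists_adj_dist h
  rw [par, dif_pos h]; exact h.choose_spec

theorem adj_par (hG : G.IsTree) (h : a ≠ w) : G.Adj (G.par a w) w := (hG.par_spec h).1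

theorem dist_par (hG : G.IsTree) (h : a ≠ w) : G.dist a (G.par a w) + 1 = G.dist a w :=
  (hG.par_spec h).2

theorem eq_par (hG : G.IsTree) (hb : G.Adj b w) (h : G.dist a b + 1 = G.dist a w) :
    b = G.par a w := by
  have hne : a ≠ w := by rintro rfl; simp at h
  exact hG.eq_of_dist hb (hG.adj_par hne) h (hG.dist_par hne)

theorem par_of_adj (hG : G.IsTree) (h : G.Adj a w) : G.par a w = a :=
  (hG.eq_par h (by rw [dist_self, dist_eq_one_iff_adj.2 h])).symm

theorem dist_of_ne_par (hG : G.IsTree) (h : G.Adj w x) (hx : x ≠ G.par a w) :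
    G.dist a x = G.dist a w + 1 := by
  rcases hG.dist_eq_dist_add_one_of_adj a h with h' | h'
  · exact (hx (hG.eq_par h.symm h'.symm)).elim
  · exact h'

theorem par_of_ne_par (hG : G.IsTree) (h : G.Adj w x) (hx : x ≠ G.par a w) : G.par a x = w :=
  (hG.eq_par h (hG.dist_of_ne_par h hx).symm).symm

theorem dist_eq_zero (hG : G.IsTree) : G.dist a b = 0 ↔ a = b := hG.connected.dist_eq_zero_iff

theorem dist_pos (hG : G.IsTree) (h : a ≠ b) : 0 < G.dist a b := hG.connected.pos_dist_of_ne h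

/-- Two neighbors of a vertex have no other common neighbor. -/
theorem eq_of_adj (hG : G.IsTree) (hxy : x ≠ y) (h1 : G.Adj z x) (h2 : G.Adj z y)
    (h3 : G.Adj w x) (h4 : G.Adj w y) : w = z := by
  have hd : ∀ {s}, G.Adj s x → G.Adj s y → G.dist x y = 2 := fun {s} h h' => by
    rcases hG.dist_eq_dist_add_one_of_adj x h' with h5 | h5
    · rw [dist_eq_one_iff_adj.2 h.symm] at h5
      exact (hxy (hG.dist_eq_zero.1 (by omega))).elim
    · rw [h5, dist_eq_one_iff_adj.2 h.symm]
  exact hG.eq_of_dist (a := x) h4 h2 (by rw [hd h3 h4, dist_eq_one_iff_adj.2 h3.symm])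
    (by rw [hd h1 h2, dist_eq_one_iff_adj.2 h1.symm])

/-- The triangle inequality forces a step from `t` towards `z` to approach `a` as well. -/
theorem par_eq_of_dist (hG : G.IsTree) (h : G.dist a z + G.dist z t = G.dist a t) (hz : z ≠ t) :
    G.par z t = G.par a t := by
  have h1 := hG.dist_par hz
  refine hG.eq_par (hG.adj_par hz) ?_
  have h2 := hG.connected.dist_triangle (u := a) (v := z) (w := G.par z t)
  have h3 := hG.connected.dist_triangle (u := a) (v := G.par z t) (w := t)
  rw [dist_eq_one_iff_adj.2 (hG.adj_par hz)] at h3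
  omega

theorem par_eq_of_dist' (hG : G.IsTree) (h : G.dist a z + G.dist z t = G.dist a t) (hz : z ≠ a) :
    G.par z a = G.par t a :=
  hG.par_eq_of_dist (by rw [dist_comm (u := t) (v := z), dist_comm (u := z) (v := a), dist_comm (u := t) (v := a)]; omega) hz

/-- The step from `z` towards `t` when `z` lies between `a` and `t`. -/
theorem dist_step (hG : G.IsTree) (h : G.dist a z + G.dist z t = G.dist a t) (hz : z ≠ t) :
    G.dist a (G.par t z) = G.dist a z + 1 ∧ G.dist (G.par t z) t + 1 = G.dist z t ∧
      G.par a (G.par t z) = z := by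
  have h1 := hG.dist_par hz.symm
  have hadj := hG.adj_par hz.symm
  have h2 := hG.connected.dist_triangle (u := a) (v := G.par t z) (w := t)
  have h3 := hG.connected.dist_triangle (u := a) (v := z) (w := G.par t z)
  rw [dist_eq_one_iff_adj.2 hadj.symm] at h3
  rw [dist_comm, dist_comm (u := t)] at h1
  have h4 : G.dist a (G.par t z) = G.dist a z + 1 := by omega
  exact ⟨h4, h1, (hG.eq_par hadj.symm h4.symm).symm⟩

/-- A vertex halfway between two vertices. -/
theorem exists_between (hG : G.IsTree) {n : ℕ} (h : n ≤ G.dist a t) :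
    ∃ z, G.dist a z = n ∧ G.dist z t = G.dist a t - n := by
  induction n with
  | zero => exact ⟨a, by simp, by simp⟩
  | succ n ih =>
    obtain ⟨z, h1, h2⟩ := ih (by omega)
    have hz : z ≠ t := by rintro rfl; simp at h2; omega
    have := hG.dist_step (a := a) (t := t) (by omega) hz
    exact ⟨G.par t z, by omega, by omega⟩

end IsTree

/-! ### Branches and centroids -/

section Branch

variable [Fintype V]

open Classical in
/-- The neighbors of `w` other than `b`. -/
noncomputable def kids (G : SimpleGraph V) (b w : V) : Finset V := {x | G.Adj w x ∧ x ≠ b}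

open Classical in
/-- The vertices that are closer to `w` than to its neighbor `b`. -/
noncomputable def branch (G : SimpleGraph V) (b w : V) : Finset V :=
  {c | G.dist b c = G.dist w c + 1}

@[simp] theorem mem_kids : x ∈ G.kids b w ↔ G.Adj w x ∧ x ≠ b := by simp [kids]

@[simp] theorem mem_kids_self : x ∈ G.kids w w ↔ G.Adj w x := by
  simp only [mem_kids, and_iff_left_iff_imp]; exact fun h => h.ne'

@[simp] theorem mem_branch : c ∈ G.branch b w ↔ G.dist b c = G.dist w c + 1 := by simp [branch]

theorem self_mem_branch (h : G.Adj b w) : w ∈ G.branch b w := by simp [h]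

namespace IsTree

theorem eq_par_of_mem_branch (hG : G.IsTree) (h : G.Adj b w) (hc : c ∈ G.branch b w) :
    w = G.par c b :=
  hG.eq_par h.symm (by rw [mem_branch] at hc; rw [dist_comm, ← hc, dist_comm])

theorem disjoint_branch (hG : G.IsTree) (hx : G.Adj w x) (hy : G.Adj w y) (hxy : x ≠ y) :
    Disjoint (G.branch w x) (G.branch w y) :=
  Finset.disjoint_left.2 fun _ hcx hcy =>
    hxy ((hG.eq_par_of_mem_branch hx hcx).trans (hG.eq_par_of_mem_branch hy hcy).symm)

/-- A vertex behind `x` determines `x` as the step from `w` towards it, so the step from `w` to `b ≠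
x` leads away from it. -/
theorem branch_subset [DecidableEq V] (hG : G.IsTree) (h : G.Adj b w) (hx : x ∈ G.kids b w) :
    G.branch w x ⊆ G.branch b w \ {w} := by
  intro c hc
  rw [mem_kids] at hx
  have hpx := hG.eq_par_of_mem_branch hx.1 hc
  rw [Finset.mem_sdiff, Finset.mem_singleton]
  refine ⟨?_, ?_⟩
  rotate_left
  · rintro rfl; simp at hc
  · rw [mem_branch]
    rcases hG.dist_eq_dist_add_one_of_adj c h with h' | h'
    · rwa [dist_comm, dist_comm (u := w)]
    · exact (hx.2 (hpx.trans (hG.eq_par h h'.symm).symm)).elim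

theorem sum_card_branch_lt (hG : G.IsTree) (h : G.Adj b w) :
    ∑ x ∈ G.kids b w, (G.branch w x).card < (G.branch b w).card := by
  classical
  rw [← Finset.card_biUnion fun x hx y hy hxy => hG.disjoint_branch
    (mem_kids.1 hx).1 (mem_kids.1 hy).1 hxy]
  refine (Finset.card_le_card (Finset.biUnion_subset.2 fun x hx => hG.branch_subset h hx)).trans_lt
    (Finset.card_lt_card (Finset.sdiff_ssubset (by simpa using self_mem_branch h) (by simp)))

theorem card_branch_lt (hG : G.IsTree) (h : G.Adj b w) (hx : x ∈ G.kids b w) :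
    (G.branch w x).card < (G.branch b w).card :=
  (Finset.single_le_sum (f := fun x => (G.branch w x).card) (fun _ _ => Nat.zero_le _) hx).trans_lt
    (hG.sum_card_branch_lt h)

theorem sum_card_branch_lt_card (hG : G.IsTree) (z : V) :
    ∑ x ∈ G.kids z z, (G.branch z x).card < Fintype.card V := by
  classical
  rw [← Finset.card_biUnion fun x hx y hy hxy => hG.disjoint_branch
    (mem_kids.1 hx).1 (mem_kids.1 hy).1 hxy]
  exact Finset.card_lt_univ_of_notMem (x := z) (by simp)

theorem card_branch_add (hG : G.IsTree) (h : G.Adj b w) :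
    (G.branch b w).card + (G.branch w b).card = Fintype.card V := by
  classical
  rw [← Finset.card_union_of_disjoint, ← Finset.card_univ]
  · congr 1
    ext c
    have := hG.dist_eq_dist_add_one_of_adj c h
    simp only [Finset.mem_union, mem_branch, Finset.mem_univ, iff_true]
    rwa [dist_comm, dist_comm (u := w)]
  · refine Finset.disjoint_left.2 fun c h1 h2 => ?_
    simp only [mem_branch] at h1 h2
    omega

/-- A centroid: no branch at `z` has more than half of the vertices. -/
theorem exists_centroid (hG : G.IsTree) :
    ∃ z, ∀ x, G.Adj z x → 2 * (G.branch z x).card ≤ Fintype.card V := by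
  classical
  by_contra! hcon
  -- Among the edges with a heavy branch take one with the smallest branch. A heavy branch at its
  -- head either points back, and then two complementary branches are both heavy, or is smaller.
  let s : Finset (V × V) :=
    {d | G.Adj d.1 d.2 ∧ Fintype.card V < 2 * (G.branch d.1 d.2).card}
  have hs : s.Nonempty := by
    obtain ⟨z⟩ := hG.connected.nonempty
    obtain ⟨x, hx⟩ := hcon z
    exact ⟨(z, x), by simpa [s] using hx⟩
  obtain ⟨⟨b, w⟩, hd, hmin⟩ := s.exists_min_image (fun d => (G.branch d.1 d.2).card) hs
  simp only [s, Finset.mem_filter, Finset.mem_univ, true_and] at hd hmin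
  obtain ⟨x, hx, hx2⟩ := hcon w
  by_cases hxb : x = b
  · subst hxb
    have := hG.card_branch_add hx
    omega
  · have h1 := hG.card_branch_lt hd.1 (mem_kids.2 ⟨hx, hxb⟩)
    have h2 := hmin (w, x) ⟨hx, hx2⟩
    simp only at h2
    omega

end IsTree

end Branch

end SimpleGraph

/-! ### Types of branches with capped multiplicities -/

/-- Finite rooted colored trees, used as isomorphism types of branches up to multiplicity. -/
inductive ColoredBranch (C : Type*) where
  | node : C → List (ColoredBranch C) → ColoredBranch C

/-- The number of vertices. -/
def ColoredBranch.size {C : Type*} : ColoredBranch C → ℕ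
  | node _ l => 1 + (l.attach.map fun t => t.1.size).sum
decreasing_by
  have := List.sizeOf_lt_of_mem t.2
  simp; omega

theorem ColoredBranch.size_node {C : Type*} (c : C) (l : List (ColoredBranch C)) :
    (node c l).size = 1 + (l.map size).sum := by
  have h := congrArg (List.map size) (List.attach_map_subtype_val l)
  rw [List.map_map] at h
  rw [size, ← h]
  rfl

theorem ColoredBranch.size_pos {C : Type*} (t : ColoredBranch C) : 0 < t.size := by
  cases t; rw [size_node]; omega

open Classical in
/-- The multiset `s` with all multiplicities cut off at `k`. -/
noncomputable def Multiset.truncate {α : Type*} (k : ℕ) (s : Multiset α) : Multiset α :=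
  s ∩ k • s.dedup

open Classical in
theorem Multiset.count_truncate {α : Type*} (k : ℕ) (s : Multiset α) (a : α) :
    (s.truncate k).count a = min k (s.count a) := by
  rw [truncate, count_inter, count_nsmul, count_dedup]
  split_ifs with h
  · rw [mul_one, min_comm]
  · simp [count_eq_zero_of_notMem h]

theorem Multiset.truncate_le {α : Type*} (k : ℕ) (s : Multiset α) : s.truncate k ≤ s := by
  classical
  rw [le_iff_count]
  intro a
  rw [count_truncate]
  exact min_le_right _ _

namespace ColoredGraph

variable {C V W : Type*} [Fintype V] [Fintype W] {k : ℕ} {G : ColoredGraph C V}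
  {H : ColoredGraph C W} {b c w x z : V} {b' c' w' x' z' : W}

/-- Approximations of `branchType`: the type of the branch at `w` after removal of `b`, up to the
depth given as the third argument. -/
noncomputable def typeAux (k : ℕ) (G : ColoredGraph C V) : ℕ → V → V → ColoredBranch C
  | 0, _, w => .node (G.color w) []
  | n + 1, b, w => .node (G.color w)
      (((G.graph.kids b w).val.map (typeAux k G n w)).truncate k).toList

/-- The type of the branch at `w` away from its neighbor `b`: the isomorphism type of the rooted
tree that is obtained by recursively cutting off at `k` the multiplicity of every type among the
children of a vertex. For `b = w` it is the type of the whole tree rooted at `w`. -/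
noncomputable def branchType (k : ℕ) (G : ColoredGraph C V) (b w : V) : ColoredBranch C :=
  typeAux k G (Fintype.card V) b w

open Classical in
/-- The number of children of `w` of type `σ`, where `b` is the parent of `w`. -/
noncomputable def kidCount (k : ℕ) (G : ColoredGraph C V) (b w : V) (σ : ColoredBranch C) : ℕ :=
  ((G.graph.kids b w).filter fun x => G.branchType k w x = σ).card

/-- Branches shrink strictly on the way down, so depth beyond the size of the branch is never used.
-/
theorem typeAux_succ (hG : G.IsTree) (n : ℕ) (h : G.graph.Adj b w)
    (hn : (G.graph.branch b w).card ≤ n) : typeAux k G (n + 1) b w = typeAux k G n b w := by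
  induction n generalizing b w with
  | zero =>
    have := Finset.card_pos.2 ⟨w, SimpleGraph.self_mem_branch h⟩
    omega
  | succ n ih =>
    rw [typeAux, typeAux]
    congr 3
    refine Multiset.map_congr rfl fun x hx => ?_
    have := hG.card_branch_lt h hx
    exact ih (SimpleGraph.mem_kids.1 hx).1 (by omega)

/-- The fixed depth disappears from the recursion, since the branches at the children miss `w` and
can afford one level less. -/
theorem branchType_eq (hG : G.IsTree) (h : G.graph.Adj b w ∨ b = w) :
    G.branchType k b w = .node (G.color w)
      (((G.graph.kids b w).val.map (G.branchType k w)).truncate k).toList := by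
  have hs : ∀ x, G.graph.Adj w x →
      typeAux k G (Fintype.card V + 1) w x = G.branchType k w x := fun x hx =>
    typeAux_succ hG _ hx (Finset.card_le_univ _)
  obtain ⟨n, hn⟩ : ∃ n, Fintype.card V = n + 1 :=
    Nat.exists_eq_succ_of_ne_zero (Fintype.card_pos_iff.2 ⟨w⟩).ne'
  rw [branchType, hn, typeAux]
  congr 3
  refine Multiset.map_congr rfl fun x hx => ?_
  have hx' : G.graph.Adj w x ∧ x ≠ b := SimpleGraph.mem_kids.1 hx
  have hlt : (G.graph.branch w x).card < Fintype.card V := by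
    refine Finset.card_lt_univ_of_notMem (x := w) ?_
    simp
  rw [branchType, hn]
  exact (typeAux_succ hG n hx'.1 (by omega)).symm

open Classical in
theorem count_map_branchType (σ : ColoredBranch C) :
    ((G.graph.kids b w).val.map (G.branchType k w)).count σ = G.kidCount k b w σ := by
  rw [Multiset.count_map, kidCount, Finset.card_def, Finset.filter_val]
  simp_rw [eq_comm]

theorem kidCount_pos (hx : x ∈ G.graph.kids b w) : 0 < G.kidCount k b w (G.branchType k w x) := by
  classical
  exact Finset.card_pos.2 ⟨x, Finset.mem_filter.2 ⟨hx, rfl⟩⟩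

theorem exists_of_kidCount_pos {σ : ColoredBranch C} (h : 0 < G.kidCount k b w σ) :
    ∃ x ∈ G.graph.kids b w, G.branchType k w x = σ := by
  classical
  obtain ⟨x, hx⟩ := Finset.card_pos.1 h
  exact ⟨x, Finset.mem_filter.1 hx⟩

/-- `toList` depends on the multiset alone, so the order of the children is harmless and types are
compared through capped counts. -/
theorem branchType_eq_iff (hG : G.IsTree) (hH : H.IsTree) (h : G.graph.Adj b w ∨ b = w)
    (h' : H.graph.Adj b' w' ∨ b' = w') :
    G.branchType k b w = H.branchType k b' w' ↔ G.color w = H.color w' ∧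
      ∀ σ, min k (G.kidCount k b w σ) = min k (H.kidCount k b' w' σ) := by
  classical
  rw [branchType_eq hG h, branchType_eq hH h', ColoredBranch.node.injEq]
  refine and_congr_right fun _ => ?_
  simp_rw [← count_map_branchType, ← Multiset.count_truncate]
  rw [← Multiset.ext]
  refine ⟨fun h => ?_, fun h => by rw [h]⟩
  rw [← Multiset.coe_toList (Multiset.truncate k _), h, Multiset.coe_toList]

theorem size_branchType (hG : G.IsTree) (h : G.graph.Adj b w ∨ b = w) :
    (G.branchType k b w).size =
      1 + ((((G.graph.kids b w).val.map (G.branchType k w)).truncate k).map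
        ColoredBranch.size).sum := by
  rw [branchType_eq hG h, ColoredBranch.size_node, ← Multiset.sum_coe, ← Multiset.map_coe,
    Multiset.coe_toList]

/-- Capping only discards children. This ties type sizes to the number of vertices. -/
theorem size_branchType_le (hG : G.IsTree) (h : G.graph.Adj b w) :
    (G.branchType k b w).size ≤ (G.graph.branch b w).card := by
  induction hn : (G.graph.branch b w).card using Nat.strong_induction_on generalizing b w with
  | _ n ih =>
    rw [size_branchType hG (.inl h)]
    obtain ⟨u, hu⟩ := Multiset.le_iff_exists_add.1 (Multiset.map_le_map (f := ColoredBranch.size)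
      (Multiset.truncate_le k ((G.graph.kids b w).val.map (G.branchType k w))))
    have h1 := congrArg Multiset.sum hu
    rw [Multiset.map_map, Multiset.sum_add] at h1
    have h2 : ∑ x ∈ G.graph.kids b w, (G.branchType k w x).size ≤
        ∑ x ∈ G.graph.kids b w, (G.graph.branch w x).card :=
      Finset.sum_le_sum fun x hx =>
        ih _ (hn ▸ hG.card_branch_lt h hx) (SimpleGraph.mem_kids.1 hx).1 rfl
    have h3 := hG.sum_card_branch_lt h
    have h4 : ((G.graph.kids b w).val.map (ColoredBranch.size ∘ G.branchType k w)).sum =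
      ∑ x ∈ G.graph.kids b w, (G.branchType k w x).size := rfl
    omega

theorem size_branchType_lt (hG : G.IsTree) (hk : 0 < k) (h : G.graph.Adj b w ∨ b = w)
    (hx : x ∈ G.graph.kids b w) : (G.branchType k w x).size < (G.branchType k b w).size := by
  classical
  rw [size_branchType hG h]
  have : G.branchType k w x ∈ ((G.graph.kids b w).val.map (G.branchType k w)).truncate k := by
    rw [← Multiset.count_pos, Multiset.count_truncate, count_map_branchType]
    exact lt_min hk (kidCount_pos hx)
  have := Multiset.single_le_sum (fun _ _ => Nat.zero_le _) _
    (Multiset.mem_map_of_mem ColoredBranch.size this)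
  omega

/-- A type that occurs at two neighbors of a vertex has less than half of the size of the tree. -/
theorem two_mul_size_lt (hG : G.IsTree) {σ : ColoredBranch C} (h : 2 ≤ G.kidCount k z z σ) :
    2 * σ.size < Fintype.card V := by
  classical
  have h1 := hG.sum_card_branch_lt_card z
  have h2 : ∑ x ∈ (G.graph.kids z z).filter fun x => G.branchType k z x = σ, σ.size ≤
      ∑ x ∈ G.graph.kids z z, (G.graph.branch z x).card := by
    refine (Finset.sum_le_sum fun x hx => ?_).trans
      (Finset.sum_le_sum_of_subset (Finset.filter_subset _ _))
    obtain ⟨hx1, rfl⟩ := Finset.mem_filter.1 hx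
    exact size_branchType_le hG (SimpleGraph.mem_kids_self.1 hx1)
  rw [Finset.sum_const, smul_eq_mul] at h2
  have h3 := Nat.mul_le_mul_right σ.size h
  rw [kidCount] at h3
  omega

open Classical in
-- Rooting at `w` turns the parent `b` into one more child.
theorem kidCount_self (h : G.graph.Adj b w) (σ : ColoredBranch C) :
    G.kidCount k w w σ = G.kidCount k b w σ + if G.branchType k w b = σ then 1 else 0 := by
  have h1 : G.graph.kids w w = insert b (G.graph.kids b w) := by
    ext x
    simp only [SimpleGraph.mem_kids_self, Finset.mem_insert, SimpleGraph.mem_kids]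
    constructor
    · intro hx; by_cases hxb : x = b <;> simp [hxb, hx]
    · rintro (rfl | hx)
      · exact h.symm
      · exact hx.1
  rw [kidCount, h1, Finset.filter_insert]
  split_ifs with h2
  · rw [Finset.card_insert_of_notMem (by simp)]; rfl
  · rfl

end ColoredGraph

/-! ### Ancestors in a rooted tree -/

namespace SimpleGraph.IsTree

variable {V : Type*} {G : SimpleGraph V} {s t x y z : V}

theorem adj_par_or (hG : G.IsTree) (z s : V) : G.Adj (G.par z s) s ∨ G.par z s = s := by
  by_cases h : z = s
  · subst h; exact .inr SimpleGraph.par_self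
  · exact .inl (hG.adj_par h)

theorem adj_iff_par (hG : G.IsTree) (z : V) :
    G.Adj s t ↔ (s ≠ z ∧ G.par z s = t) ∨ (t ≠ z ∧ G.par z t = s) := by
  constructor
  · intro h
    rcases hG.dist_eq_dist_add_one_of_adj z h with h' | h'
    · exact .inl ⟨by rintro rfl; simp at h', (hG.eq_par h.symm h'.symm).symm⟩
    · exact .inr ⟨by rintro rfl; simp at h', (hG.eq_par h h'.symm).symm⟩
  · rintro (⟨h, rfl⟩ | ⟨h, rfl⟩)
    · exact (hG.adj_par h.symm).symm
    · exact hG.adj_par h.symm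

/-- The convention that the root is its own parent makes this uniform in `s`, including `s = z`. -/
theorem mem_kids_par [Fintype V] (hG : G.IsTree) :
    x ∈ G.kids (G.par z s) s ↔ x ≠ z ∧ G.par z x = s := by
  rw [mem_kids]
  constructor
  · rintro ⟨h1, h2⟩
    have := hG.dist_of_ne_par h1 h2
    exact ⟨by rintro rfl; simp at this, hG.par_of_ne_par h1 h2⟩
  · rintro ⟨h, rfl⟩
    refine ⟨hG.adj_par h.symm, fun hx => ?_⟩
    have h1 := hG.dist_par h.symm
    by_cases h2 : z = G.par z x
    · rw [← h2, par_self] at hx; exact h hx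
    · have h3 := hG.dist_par h2
      rw [← hx] at h3; omega

theorem dist_iterate_par_le (hG : G.IsTree) (n : ℕ) :
    G.dist z ((G.par z)^[n] x) ≤ G.dist z x := by
  induction n generalizing x with
  | zero => simp
  | succ n ih =>
    rw [Function.iterate_succ_apply]
    refine ih.trans ?_
    by_cases h : z = x
    · subst h; simp [par_self]
    · have := hG.dist_par h; omega

/-- Different children of a vertex have no common descendants. -/
theorem eq_of_iterate_par (hG : G.IsTree) (hs : s ≠ z) (ht : t ≠ z) (h : G.par z s = G.par z t)
    {m n : ℕ} (hm : (G.par z)^[m] x = s) (hn : (G.par z)^[n] x = t) : s = t := by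
  wlog hmn : m ≤ n generalizing m n s t
  · exact (this ht hs h.symm hn hm (by omega)).symm
  obtain ⟨e, rfl⟩ := Nat.exists_eq_add_of_le hmn
  rw [add_comm, Function.iterate_add_apply, hm] at hn
  cases e with
  | zero => simpa using hn
  | succ e =>
    rw [Function.iterate_succ_apply] at hn
    have h1 := hG.dist_iterate_par_le (z := z) (x := G.par z s) e
    rw [hn, h] at h1
    have h2 := hG.dist_par ht.symm
    omega

end SimpleGraph.IsTree

/-! ### Duplicator's strategy -/

namespace ColoredGraph

variable {C V W : Type*} [Fintype V] [Fintype W] {k : ℕ} {G : ColoredGraph C V}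
  {H : ColoredGraph C W} {z : V} {z' : W} {S : Set V} {f : V → W}

/-- `f` embeds the ancestor-closed set `S` of the tree `G` with root `z` into the tree `H` with
root `z'` and preserves the types of the branches. -/
structure RootedEmbedding (k : ℕ) (G : ColoredGraph C V) (H : ColoredGraph C W) (z : V) (z' : W)
    (S : Set V) (f : V → W) : Prop where
  root_mem : z ∈ S
  map_root : f z = z'
  injOn : Set.InjOn f S
  type_eq : ∀ s ∈ S,
    G.branchType k (G.graph.par z s) s = H.branchType k (H.graph.par z' (f s)) (f s)
  par_mem : ∀ s ∈ S, s ≠ z → G.graph.par z s ∈ S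
  map_ne : ∀ s ∈ S, s ≠ z → f s ≠ z'
  map_par : ∀ s ∈ S, s ≠ z → H.graph.par z' (f s) = f (G.graph.par z s)

namespace RootedEmbedding

theorem anti (h : RootedEmbedding k G H z z' S f) {T : Set V} (hTS : T ⊆ S) (hz : z ∈ T)
    (hT : ∀ s ∈ T, s ≠ z → G.graph.par z s ∈ T) : RootedEmbedding k G H z z' T f where
  root_mem := hz
  map_root := h.map_root
  injOn := h.injOn.mono hTS
  type_eq s hs := h.type_eq s (hTS hs)
  par_mem := hT
  map_ne s hs := h.map_ne s (hTS hs)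
  map_par s hs := h.map_par s (hTS hs)

theorem symm (h : RootedEmbedding k G H z z' S f) :
    ∃ g : W → V, RootedEmbedding k H G z' z (f '' S) g ∧ ∀ s ∈ S, g (f s) = s := by
  have : Nonempty V := ⟨z⟩
  have hl : ∀ s ∈ S, Function.invFunOn f S (f s) = s := fun s hs =>
    h.injOn.leftInvOn_invFunOn hs
  have hne : ∀ s ∈ S, f s ≠ z' → s ≠ z := fun s _ hs hsz => hs (hsz ▸ h.map_root)
  refine ⟨Function.invFunOn f S, ⟨⟨z, h.root_mem, h.map_root⟩, ?_, ?_, ?_, ?_, ?_, ?_⟩, hl⟩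
  · rw [← h.map_root]; exact hl z h.root_mem
  · rintro _ ⟨s, hs, rfl⟩ _ ⟨t, ht, rfl⟩ hst
    rw [hl s hs, hl t ht] at hst; rw [hst]
  · rintro _ ⟨s, hs, rfl⟩; rw [hl s hs]; exact (h.type_eq s hs).symm
  · rintro _ ⟨s, hs, rfl⟩ hsz
    exact ⟨_, h.par_mem s hs (hne s hs hsz), (h.map_par s hs (hne s hs hsz)).symm⟩
  · rintro _ ⟨s, hs, rfl⟩ hsz; rw [hl s hs]; exact hne s hs hsz
  · rintro _ ⟨s, hs, rfl⟩ hsz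
    rw [hl s hs, h.map_par s hs (hne s hs hsz), hl _ (h.par_mem s hs (hne s hs hsz))]

theorem adj_iff (h : RootedEmbedding k G H z z' S f) (hG : G.IsTree) (hH : H.IsTree) {s t : V}
    (hs : s ∈ S) (ht : t ∈ S) : G.graph.Adj s t ↔ H.graph.Adj (f s) (f t) := by
  have key : ∀ s ∈ S, ∀ t ∈ S,
      (s ≠ z ∧ G.graph.par z s = t) ↔ (f s ≠ z' ∧ H.graph.par z' (f s) = f t) := by
    intro s hs t ht
    constructor
    · rintro ⟨h1, rfl⟩
      exact ⟨h.map_ne s hs h1, h.map_par s hs h1⟩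
    · rintro ⟨h1, h2⟩
      have h3 : s ≠ z := fun e => h1 (e ▸ h.map_root)
      exact ⟨h3, h.injOn (h.par_mem s hs h3) ht (by rw [← h2, h.map_par s hs h3])⟩
  rw [hG.adj_iff_par z, hH.adj_iff_par z', key s hs t ht, key t ht s hs]

theorem color_eq (h : RootedEmbedding k G H z z' S f) (hG : G.IsTree) (hH : H.IsTree) {s : V}
    (hs : s ∈ S) : G.color s = H.color (f s) :=
  ((branchType_eq_iff hG hH (hG.adj_par_or z s) (hH.adj_par_or z' (f s))).1 (h.type_eq s hs)).1

open Classical in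
-- Fewer than `k` children of `s` are occupied, and `y` is a further one of its type; since the
-- capped counts agree, `f s` has an unoccupied child of that type too.
theorem extend_kid (h : RootedEmbedding k G H z z' S f) (hG : G.IsTree) (hH : H.IsTree) {s y : V}
    (hs : s ∈ S) (hy : y ∈ G.graph.kids (G.graph.par z s) s) (hyS : y ∉ S)
    (hcard : ((G.graph.kids (G.graph.par z s) s).filter (· ∈ S)).card < k) :
    ∃ y', RootedEmbedding k G H z z' (insert y S) (Function.update f y y') := by
  set σ := G.branchType k s y with hσ
  have hcount := ((branchType_eq_iff hG hH (hG.adj_par_or z s)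
    (hH.adj_par_or z' (f s))).1 (h.type_eq s hs)).2 σ
  let A := ((G.graph.kids (G.graph.par z s) s).filter fun x => G.branchType k s x = σ).filter (· ∈ S)
  have hA : A.card < k := by
    refine lt_of_le_of_lt (Finset.card_le_card ?_) hcard
    intro x hx
    simp only [A, Finset.mem_filter] at hx ⊢
    exact ⟨hx.1.1, hx.2⟩
  have hA' : A.card < G.kidCount k (G.graph.par z s) s σ := by
    refine Finset.card_lt_card (Finset.filter_ssubset.2 ⟨y, ?_, hyS⟩)
    simp [← hσ, SimpleGraph.mem_kids.1 hy]
  have hB : (A.image f).card < H.kidCount k (H.graph.par z' (f s)) (f s) σ := by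
    have := Finset.card_image_le (s := A) (f := f)
    omega
  obtain ⟨y', hy', hy'A⟩ := Finset.exists_mem_notMem_of_card_lt_card hB
  rw [Finset.mem_filter] at hy'
  obtain ⟨hy'1, hy'2⟩ := hy'
  have hpy := hG.mem_kids_par.1 hy
  have hpy' := hH.mem_kids_par.1 hy'1
  have hnot : ∀ t ∈ S, f t ≠ y' := by
    rintro t ht rfl
    have htz : t ≠ z := fun e => hpy'.1 (e ▸ h.map_root)
    have h1 := h.map_par t ht htz
    have h2 : G.graph.par z t = s := h.injOn (h.par_mem t ht htz) hs (by rw [← h1, hpy'.2])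
    refine hy'A (Finset.mem_image_of_mem f ?_)
    simp only [A, Finset.mem_filter]
    refine ⟨⟨hG.mem_kids_par.2 ⟨htz, h2⟩, ?_⟩, ht⟩
    have := h.type_eq t ht
    rwa [h2, h1, h2, hy'2] at this
  have hne : ∀ t ∈ S, t ≠ y := fun t ht e => hyS (e ▸ ht)
  refine ⟨y', ⟨.inr h.root_mem, ?_, ?_, ?_, ?_, ?_, ?_⟩⟩
  · rw [Function.update_of_ne (hne z h.root_mem), h.map_root]
  · rintro t (rfl | ht) u (rfl | hu) htu
    · rfl
    · rw [Function.update_self, Function.update_of_ne (hne u hu)] at htu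
      exact (hnot u hu htu.symm).elim
    · rw [Function.update_self, Function.update_of_ne (hne t ht)] at htu
      exact (hnot t ht htu).elim
    · rw [Function.update_of_ne (hne u hu), Function.update_of_ne (hne t ht)] at htu
      exact h.injOn ht hu htu
  · rintro t (rfl | ht)
    · rw [Function.update_self, hpy.2, hpy'.2, hy'2]
    · rw [Function.update_of_ne (hne t ht), h.type_eq t ht]
  · rintro t (rfl | ht) htz
    · rw [hpy.2]; exact .inr hs
    · exact .inr (h.par_mem t ht htz)
  · rintro t (rfl | ht) htz
    · rw [Function.update_self]; exact hpy'.1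
    · rw [Function.update_of_ne (hne t ht)]; exact h.map_ne t ht htz
  · rintro t (rfl | ht) htz
    · rw [Function.update_self, hpy'.2, hpy.2, Function.update_of_ne (hne s hs)]
    · rw [Function.update_of_ne (hne t ht), h.map_par t ht htz,
        Function.update_of_ne (hne _ (h.par_mem t ht htz))]

open Classical in
-- The path from the root to `y` is added from the top. The final clause records that the vertices
-- added so far are no deeper than the parent of `y`, so they do not increase its number of occupied
-- children.
theorem extend (h : RootedEmbedding k G H z z' S f) (hG : G.IsTree) (hH : H.IsTree)
    (hcard : ∀ s, ((G.graph.kids (G.graph.par z s) s).filter (· ∈ S)).card < k) (y : V) :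
    ∃ T g, RootedEmbedding k G H z z' T g ∧ S ⊆ T ∧ Set.EqOn g f S ∧ y ∈ T ∧
      ∀ x ∈ T, x ∈ S ∨ G.graph.dist z x ≤ G.graph.dist z y := by
  induction hd : G.graph.dist z y generalizing y with
  | zero =>
    have := hG.dist_eq_zero.1 hd
    subst this
    exact ⟨S, f, h, subset_rfl, fun _ _ => rfl, h.root_mem, fun x hx => .inl hx⟩
  | succ n ih =>
    have hyz : y ≠ z := by rintro rfl; simp at hd
    have hp := hG.dist_par hyz.symm
    obtain ⟨T, g, hT, hST, hgf, hyT, hx⟩ := ih (G.graph.par z y) (by omega)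
    by_cases hy : y ∈ T
    · exact ⟨T, g, hT, hST, hgf, hy, fun x hxT => (hx x hxT).imp id (by omega)⟩
    have hk := hG.mem_kids_par.2 ⟨hyz, rfl⟩
    obtain ⟨y', hy'⟩ := hT.extend_kid hG hH hyT hk hy (by
      refine lt_of_le_of_lt (Finset.card_le_card fun x hxm => ?_) (hcard (G.graph.par z y))
      rw [Finset.mem_filter] at hxm ⊢
      refine ⟨hxm.1, (hx x hxm.2).resolve_right ?_⟩
      have h1 := hG.mem_kids_par.1 hxm.1
      have h2 := hG.dist_par h1.1.symm
      rw [h1.2] at h2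
      omega)
    refine ⟨_, _, hy', hST.trans (Set.subset_insert _ _), fun t ht => ?_, .inl rfl, ?_⟩
    · rw [Function.update_of_ne (ne_of_mem_of_not_mem (hST ht) hy), hgf ht]
    · rintro x (rfl | hxT)
      · exact .inr hd.le
      · exact (hx x hxT).imp id (by omega)

open Classical in
-- Lifting pebble `i` allows all vertices that are not ancestors of another pebble to be forgotten.
-- Distinct remaining children of a vertex lie above distinct pebbles, so there are at most `k - 1`
-- of them.
theorem exists_update {p : Fin k → V} {q : Fin k → W} (hG : G.IsTree) (hH : H.IsTree)
    (h : RootedEmbedding k G H z z' S f) (hp : ∀ j, p j ∈ S ∧ f (p j) = q j) (i : Fin k) (x : V) :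
    ∃ x' T g, RootedEmbedding k G H z z' T g ∧ ∀ j, Function.update p i x j ∈ T ∧
      g (Function.update p i x j) = Function.update q i x' j := by
  let S₀ : Set V := {s | s ∈ S ∧ (s = z ∨ ∃ j ≠ i, ∃ n, (G.graph.par z)^[n] (p j) = s)}
  have h₀ : RootedEmbedding k G H z z' S₀ f := by
    refine h.anti (fun s hs => hs.1) ⟨h.root_mem, .inl rfl⟩ ?_
    rintro s ⟨hs, hs'⟩ hsz
    obtain ⟨j, hj, n, hn⟩ := hs'.resolve_left hsz
    exact ⟨h.par_mem s hs hsz, .inr ⟨j, hj, n + 1, by rw [Function.iterate_succ_apply', hn]⟩⟩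
  have hcard : ∀ s, ((G.graph.kids (G.graph.par z s) s).filter (· ∈ S₀)).card < k := by
    intro s
    have hsub : ∀ c ∈ (G.graph.kids (G.graph.par z s) s).filter (· ∈ S₀),
        ∃ j : Fin k, j ≠ i ∧ ∃ n, (G.graph.par z)^[n] (p j) = c := by
      intro c hc
      obtain ⟨hc1, hc2⟩ := Finset.mem_filter.1 hc
      exact hc2.2.resolve_left (hG.mem_kids_par.1 hc1).1
    have : Nonempty (Fin k) := ⟨i⟩
    choose! j hj n hn using hsub
    have hlt : (Finset.univ.erase i : Finset (Fin k)).card < k := by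
      rw [Finset.card_erase_of_mem (Finset.mem_univ _), Finset.card_univ, Fintype.card_fin]
      have := i.pos
      omega
    refine lt_of_le_of_lt (Finset.card_le_card_of_injOn j (fun c hc => by
      simpa using hj c hc) ?_) hlt
    intro c hc d hd hcd
    have hc1 := hG.mem_kids_par.1 (Finset.mem_filter.1 hc).1
    have hd1 := hG.mem_kids_par.1 (Finset.mem_filter.1 hd).1
    refine hG.eq_of_iterate_par hc1.1 hd1.1 (hc1.2.trans hd1.2.symm) (hn c hc)
      (n := n d) ?_
    rw [hcd]; exact hn d hd
  obtain ⟨T, g, hT, hST, hgf, hxT, -⟩ := h₀.extend hG hH (fun s => by convert hcard s) x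
  refine ⟨g x, T, g, hT, fun j => ?_⟩
  by_cases hj : j = i
  · subst hj; simp [hxT]
  · have hpj : p j ∈ S₀ := ⟨(hp j).1, .inr ⟨j, hj, 0, rfl⟩⟩
    rw [Function.update_of_ne hj, Function.update_of_ne hj]
    exact ⟨hST hpj, (hgf hpj).trans (hp j).2⟩

theorem sat_iff (hG : G.IsTree) (hH : H.IsTree) (φ : FOk C k) {p : Fin k → V} {q : Fin k → W}
    (h : RootedEmbedding k G H z z' S f) (hp : ∀ j, p j ∈ S ∧ f (p j) = q j) :
    φ.Sat G p ↔ φ.Sat H q := by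
  induction φ generalizing p q S f with
  | eq i j | ne i j =>
    have : p i = p j ↔ q i = q j := by
      rw [← (hp i).2, ← (hp j).2, h.injOn.eq_iff (hp i).1 (hp j).1]
    simp only [FOk.Sat, this]
  | adj i j | nadj i j =>
    have : G.graph.Adj (p i) (p j) ↔ H.graph.Adj (q i) (q j) := by
      rw [← (hp i).2, ← (hp j).2, h.adj_iff hG hH (hp i).1 (hp j).1]
    simp only [FOk.Sat, this]
  | col c i | ncol c i =>
    have : G.color (p i) = H.color (q i) := by
      rw [← (hp i).2, h.color_eq hG hH (hp i).1]
    simp only [FOk.Sat, this]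
  | and φ ψ h1 h2 | or φ ψ h1 h2 => simp only [FOk.Sat, h1 h hp, h2 h hp]
  | ex i φ ih | all i φ ih =>
    have h1 : ∀ x, ∃ x', φ.Sat G (Function.update p i x) ↔ φ.Sat H (Function.update q i x') := by
      intro x
      obtain ⟨x', T, g, hT, hg⟩ := h.exists_update hG hH hp i x
      exact ⟨x', ih hT hg⟩
    have h2 : ∀ x', ∃ x, φ.Sat G (Function.update p i x) ↔ φ.Sat H (Function.update q i x') := by
      intro x'
      obtain ⟨e, he, hl⟩ := h.symm
      have hq : ∀ j, q j ∈ f '' S ∧ e (q j) = p j := fun j =>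
        ⟨⟨p j, hp j⟩, by rw [← (hp j).2, hl _ (hp j).1]⟩
      obtain ⟨x, T, g, hT, hg⟩ := he.exists_update hH hG hq i x'
      obtain ⟨e', he', hl'⟩ := hT.symm
      exact ⟨x, ih he' fun j => ⟨⟨_, hg j⟩, by rw [← (hg j).2, hl' _ (hg j).1]⟩⟩
    simp only [FOk.Sat]
    choose a ha using h1
    choose b hb using h2
    first
    | exact ⟨fun ⟨x, hx⟩ => ⟨a x, (ha x).1 hx⟩, fun ⟨x, hx⟩ => ⟨b x, (hb x).2 hx⟩⟩
    | exact ⟨fun h x => (hb x).1 (h _), fun h x => (ha x).2 (h _)⟩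

end RootedEmbedding

/-- Trees that have the same type for some choice of roots agree on all sentences. -/
theorem not_distinguishes (hG : G.IsTree) (hH : H.IsTree) {z : V} {z' : W}
    (h : G.branchType k z z = H.branchType k z' z') (φ : FOk C k) : ¬ φ.Distinguishes G H := by
  rintro ⟨h0, h1, h2⟩
  refine h2 fun a => ?_
  -- All variables start at the roots, which is permitted because a sentence ignores the assignment.
  have he : RootedEmbedding k G H z z' {z} fun _ => z' := by
    refine ⟨rfl, rfl, by simp, ?_, ?_, ?_, ?_⟩
    · rintro s rfl; rw [SimpleGraph.par_self, SimpleGraph.par_self, h]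
    all_goals rintro s rfl hs; exact (hs rfl).elim
  have := (he.sat_iff hG hH φ (p := fun _ => z) (q := fun _ => z') fun j => ⟨rfl, rfl⟩).1 (h1 _)
  exact (FOk.sat_congr H φ (by simp [show φ.freeVars = ∅ from h0])).1 this

end ColoredGraph

/-! ### Vertices on and off a path -/

namespace SimpleGraph.IsTree

variable {V : Type*} {G : SimpleGraph V} {a p t x z : V}

theorem eq_of_between (hG : G.IsTree) (hz : G.dist a z + G.dist z t = G.dist a t)
    (hp : G.dist a p + G.dist p t = G.dist a t) (h : G.dist a p = G.dist a z) : p = z := by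
  induction hn : G.dist z t generalizing t with
  | zero =>
    have h1 := hG.dist_eq_zero.1 hn
    have h2 : G.dist p t = 0 := by omega
    rw [hG.dist_eq_zero.1 h2, h1]
  | succ n ih =>
    have hzt : z ≠ t := by rintro rfl; simp at hn
    have hpt : p ≠ t := by rintro rfl; simp at hp; omega
    have h1 := hG.par_eq_of_dist hz hzt
    have h2 := hG.par_eq_of_dist hp hpt
    have h3 := hG.dist_par hzt
    have h4 := hG.dist_par hpt
    have hat : a ≠ t := by rintro rfl; rw [dist_self] at hz; omega
    have h5 := hG.dist_par hat
    rw [h1] at h3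
    rw [h2] at h4
    exact ih (t := G.par a t) (by omega) (by omega) (by omega)

theorem between_or_par_eq (hG : G.IsTree) (a x t : V) :
    G.dist a x + G.dist x t = G.dist a t ∨ G.par a x = G.par t x := by
  induction hn : G.dist x t generalizing t with
  | zero => rw [hG.dist_eq_zero.1 hn]; simp
  | succ n ih =>
    have hxt : x ≠ t := by rintro rfl; simp at hn
    have h1 := hG.dist_par hxt
    have hadj := hG.adj_par hxt
    by_cases ht : G.par x t = x
    · rw [ht] at hadj
      rw [dist_eq_one_iff_adj.2 hadj] at hn
      rcases hG.dist_eq_dist_add_one_of_adj a hadj with h2 | h2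
      · right
        rw [hG.par_of_adj hadj.symm]
        exact (hG.eq_par hadj.symm h2.symm).symm
      · left; omega
    · have h2 : G.par (G.par x t) x = G.par t x := by
        refine hG.par_eq_of_dist ?_ ht
        rw [dist_eq_one_iff_adj.2 hadj.symm, dist_comm (u := G.par x t), dist_comm (u := t)]
        omega
      rcases ih (G.par x t) (by omega) with h3 | h3
      · rcases hG.dist_eq_dist_add_one_of_adj a hadj with h4 | h4
        · have h5 := hG.eq_par hadj.symm h4.symm
          rw [← hG.par_eq_of_dist (by omega) (Ne.symm ht)] at h5
          have h6 := hG.dist_par (Ne.symm ht)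
          rw [← h5] at h6
          omega
        · left; omega
      · right; rw [h3, h2]

/-- A vertex that is further from `a` and `t` by one than `z`, which lies between `a` and `t`, is
a neighbor of `z`. -/
theorem par_eq_of_between (hG : G.IsTree) (hz : G.dist a z + G.dist z t = G.dist a t)
    (h1 : G.dist a x = G.dist a z + 1) (h2 : G.dist x t = G.dist z t + 1) : G.par a x = z := by
  have h := (hG.between_or_par_eq a x t).resolve_left (by omega)
  have ha := hG.dist_par (a := a) (w := x) (by rintro rfl; simp at h1)
  have ht := hG.dist_par (a := t) (w := x) (by rintro rfl; simp at h2)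
  rw [← h, dist_comm, dist_comm (u := t)] at ht
  refine hG.eq_of_between hz ?_ (by omega)
  omega

end SimpleGraph.IsTree

/-! ### Spoiler's basic strategies: distances and neighbors -/

namespace ColoredGraph

variable {C V W : Type*} {k r : ℕ} {G : ColoredGraph C V}
  {H : ColoredGraph C W} {L : List (V × W)}

theorem IsTree.nonempty {G : ColoredGraph C V} (hG : G.IsTree) : Nonempty V :=
  hG.connected.nonempty

/-- Pebble a vertex that splits the distance into parts of length at most `2 ^ r`: by the triangle
inequality one part is again too short. Three pebbles suffice, as the other endpoint can be
released. -/
theorem wins_of_dist_lt [Finite W] (hk : 3 ≤ k) (hG : G.IsTree) (hH : H.IsTree) {x y : V} {x' y' : W}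
    (hx : (x, x') ∈ L) (hy : (y, y') ∈ L) (h : G.graph.dist x y ≤ 2 ^ r)
    (hlt : G.graph.dist x y < H.graph.dist x' y') : Wins k G H r L := by
  have := hH.nonempty
  induction r generalizing x y x' y' L with
  | zero =>
    rcases Nat.eq_zero_or_pos (G.graph.dist x y) with h0 | h0
    · rw [h0] at hlt
      refine .of_eq hx hy ?_
      rw [← hG.dist_eq_zero, ← hH.dist_eq_zero]
      omega
    · refine .of_adj hx hy ?_
      rw [← SimpleGraph.dist_eq_one_iff_adj, ← SimpleGraph.dist_eq_one_iff_adj]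
      omega
  | succ r ih =>
    obtain ⟨z, h1, h2⟩ := hG.exists_between (min_le_right (2 ^ r) (G.graph.dist x y))
    refine Wins.mono (L := [(x, x'), (y, y')]) ?_ le_rfl (by simp [hx, hy])
    refine Wins.step (by simp; omega) z fun z' => ?_
    have h3 := hH.connected.dist_triangle (u := x') (v := z') (w := y')
    rw [pow_succ] at h
    rcases lt_or_ge (G.graph.dist x z) (H.graph.dist x' z') with h4 | h4
    · exact ih (x := x) (y := z) (x' := x') (y' := z') (by simp) (by simp) (by omega) h4
    · exact ih (x := z) (y := y) (x' := z') (y' := y') (by simp) (by simp) (by omega) (by omega)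

theorem wins_of_dist_ne [Finite V] [Finite W] (hk : 3 ≤ k) (hG : G.IsTree) (hH : H.IsTree) {x y : V} {x' y' : W}
    (hx : (x, x') ∈ L) (hy : (y, y') ∈ L) (h : G.graph.dist x y ≤ 2 ^ r)
    (hne : G.graph.dist x y ≠ H.graph.dist x' y') : Wins k G H r L := by
  rcases Nat.lt_or_gt_of_ne hne with h1 | h1
  · exact wins_of_dist_lt hk hG hH hx hy h h1
  · exact .of_swap <| wins_of_dist_lt hk hH hG (List.mem_map_of_mem (f := Prod.swap) hx)
      (List.mem_map_of_mem (f := Prod.swap) hy) (h1.le.trans h) h1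

/-- Spoiler can pebble up to `k` neighbors of `z`, and then return to `z` and to the neighbor for
which Duplicator's response was wrong. -/
theorem wins_of_neighbors [Finite W] (hk : 3 ≤ k) (hG : G.IsTree) (hH : H.IsTree) {z : V} {z' : W}
    (Y : List V) (Q : List (V × W))
    (hQ : ∀ q ∈ Q, G.graph.Adj z q.1 ∧ H.graph.Adj z' q.2) (hn1 : (Q.map Prod.fst ++ Y).Nodup)
    (hn2 : (Q.map Prod.snd).Nodup) (hY : ∀ y ∈ Y, G.graph.Adj z y)
    (hlen : Q.length + Y.length ≤ k)
    (h : ∀ P : List (V × W), Q ⊆ P → (P.map Prod.fst).Perm (Q.map Prod.fst ++ Y) →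
      (P.map Prod.snd).Nodup → (∀ q ∈ P, G.graph.Adj z q.1 ∧ H.graph.Adj z' q.2) →
      ∃ q ∈ P, Wins k G H r [(z, z'), q]) :
    Wins k G H (r + Y.length + 1) ((z, z') :: Q) := by
  have := hH.nonempty
  induction Y generalizing Q with
  | nil =>
    obtain ⟨q, hq, hw⟩ := h Q (List.Subset.refl _) (by simp) hn2 hQ
    exact hw.mono (by omega) (by simp [hq])
  | cons y Y ih =>
    have hyQ : ∀ q ∈ Q, q.1 ≠ y := by
      rintro q hq rfl
      exact List.disjoint_of_nodup_append hn1 (List.mem_map_of_mem hq) (by simp)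
    have hzy : G.graph.Adj z y := hY y (by simp)
    have hz1 : ∀ q ∈ Q, ¬ G.graph.Adj y q.1 := by
      intro q hq hadj
      have := hG.dist_eq_dist_add_one_of_adj z hadj
      rw [SimpleGraph.dist_eq_one_iff_adj.2 hzy, SimpleGraph.dist_eq_one_iff_adj.2 (hQ q hq).1]
        at this
      omega
    have hfresh : ∀ y', y' ∉ Q.map Prod.snd → H.graph.Adj z' y' →
        ((((y, y') :: Q).map Prod.fst) ++ Y).Nodup ∧ (((y, y') :: Q).map Prod.snd).Nodup ∧
        ∀ q ∈ (y, y') :: Q, G.graph.Adj z q.1 ∧ H.graph.Adj z' q.2 := by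
      intro y' hy' hadj
      refine ⟨?_, by simpa [hn2] using hy', ?_⟩
      · simpa using (List.perm_middle.nodup_iff.1 hn1)
      · rintro q (_ | ⟨_, hq⟩)
        · exact ⟨hzy, hadj⟩
        · exact hQ q hq
    have hP : ∀ y' (P : List (V × W)), (y, y') :: Q ⊆ P →
        (P.map Prod.fst).Perm (((y, y') :: Q).map Prod.fst ++ Y) →
        (P.map Prod.snd).Nodup → (∀ q ∈ P, G.graph.Adj z q.1 ∧ H.graph.Adj z' q.2) →
        ∃ q ∈ P, Wins k G H r [(z, z'), q] := by
      intro y' P h1 h2 h3 h4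
      refine h P (List.Subset.trans (List.subset_cons_self _ _) h1) (h2.trans ?_) h3 h4
      simpa using List.perm_middle.symm
    simp only [List.length_cons] at hlen ⊢
    by_cases hQk : Q.length + 1 < k
    · refine Wins.mono (r := (r + Y.length + 1) + 1) ?_ (by omega) (List.Subset.refl _)
      refine Wins.step (by simpa using hQk) y fun y' => ?_
      by_cases hy' : y' ∈ Q.map Prod.snd
      · obtain ⟨q, hq, rfl⟩ := List.mem_map.1 hy'
        exact .of_eq (x := q.1) (x' := q.2) (y := y) (y' := q.2) (by simp [hq]) (by simp)
          (by simp [hyQ q hq])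
      by_cases hadj : H.graph.Adj z' y'
      · obtain ⟨h1, h2, h3⟩ := hfresh y' hy' hadj
        refine (ih ((y, y') :: Q) h3 h1 h2 (fun x hx => hY x (by simp [hx]))
          (by simp; omega) (hP y')).mono le_rfl ?_
        intro q; simp only [List.mem_cons]; tauto
      · exact .of_adj (x := z) (x' := z') (y := y) (y' := y') (by simp) (by simp)
          (by simp [hzy, hadj])
    -- The last neighbor needs the pebble on `z`. Afterwards `z` is found again as the only common
    -- neighbor of two pebbled neighbors, which is the extra round in the bound.
    · obtain rfl : Y = [] := List.length_eq_zero_iff.1 (by omega)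
      refine Wins.mono (r := (r + 1) + 1) (L := Q) ?_ (by simp) (List.subset_cons_self _ _)
      refine Wins.step (by omega) y fun y' => ?_
      by_cases hy' : y' ∈ Q.map Prod.snd
      · obtain ⟨q, hq, rfl⟩ := List.mem_map.1 hy'
        exact .of_eq (x := q.1) (x' := q.2) (y := y) (y' := q.2) (by simp [hq]) (by simp)
          (by simp [hyQ q hq])
      by_cases hadj : H.graph.Adj z' y'
      · obtain ⟨h1, h2, h3⟩ := hfresh y' hy' hadj
        obtain ⟨q, hq, hw⟩ := hP y' ((y, y') :: Q) (List.Subset.refl _) (by simp) h2 h3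
        obtain ⟨q₂, hq₂, hne⟩ : ∃ q₂ ∈ (y, y') :: Q, q.2 ≠ q₂.2 := by
          by_contra! hcon
          have h4 : ((y, y') :: Q).map Prod.snd = List.replicate (Q.length + 1) q.2 :=
            List.eq_replicate_iff.2 ⟨by simp, fun b hb => by
              obtain ⟨c, hc, rfl⟩ := List.mem_map.1 hb; exact (hcon c hc).symm⟩
          rw [h4] at h2
          have := List.nodup_replicate.1 h2
          omega
        refine Wins.mono (r := r + 1) (L := [q, q₂]) ?_ le_rfl (by
          intro p hp
          simp only [List.mem_cons, List.not_mem_nil, or_false] at hp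
          rcases hp with rfl | rfl <;> assumption)
        refine Wins.step (by simp; omega) z fun w => ?_
        by_cases hw1 : H.graph.Adj w q.2
        · by_cases hw2 : H.graph.Adj w q₂.2
          · obtain rfl := hH.eq_of_adj hne (h3 q hq).2 (h3 q₂ hq₂).2 hw1 hw2
            exact hw.mono le_rfl (by simp)
          · exact .of_adj (x := z) (x' := w) (y := q₂.1) (y' := q₂.2) (by simp) (by simp)
              (by simp [(h3 q₂ hq₂).1, hw2])
        · exact .of_adj (x := z) (x' := w) (y := q.1) (y' := q.2) (by simp) (by simp)
            (by simp [(h3 q hq).1, hw1])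
      · obtain ⟨q₁, q₂, Q', rfl⟩ : ∃ q₁ q₂ Q', Q = q₁ :: q₂ :: Q' := by
          match Q, hQk with
          | [], h => simp at h; omega
          | [_], h => simp at h; omega
          | q₁ :: q₂ :: Q', _ => exact ⟨q₁, q₂, Q', rfl⟩
        have hq₁ := hQ q₁ (by simp)
        have hq₂ := hQ q₂ (by simp)
        have hne : q₁.2 ≠ q₂.2 := fun e => by simp [e] at hn2
        by_cases hyz : y' = z'
        · subst hyz
          exact .of_adj (x := y) (x' := y') (y := q₁.1) (y' := q₁.2) (by simp) (by simp)
            (by simp [hq₁.2, hz1 q₁ (by simp)])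
        -- In `G` every pebbled neighbor shares the neighbor `z` with `y`. Common neighbors of `y'`
        -- with both `q₁.2` and `q₂.2` would lie on the path from `z'` to `y'`, and so would both of
        -- these, although the path has only one neighbor of `z'`.
        have hcommon : ∃ q ∈ [q₁, q₂], ∀ s, H.graph.Adj s y' → ¬ H.graph.Adj s q.2 := by
          by_contra! hcon
          obtain ⟨s₁, hs1, hs2⟩ := hcon q₁ (by simp)
          obtain ⟨s₂, hs3, hs4⟩ := hcon q₂ (by simp)
          have key : ∀ s x, H.graph.Adj s y' → H.graph.Adj s x → H.graph.Adj z' x →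
              H.graph.dist z' s + 1 = H.graph.dist z' y' ∧ H.graph.dist z' x + 1 =
                H.graph.dist z' s ∧ H.graph.dist z' s = 2 := by
            intro s x h1 h2 h3
            have h4 := SimpleGraph.dist_eq_one_iff_adj.2 h3
            have h5 := hH.dist_eq_dist_add_one_of_adj z' h1
            have h6 := hH.dist_eq_dist_add_one_of_adj z' h2
            have h7 : H.graph.dist z' y' ≠ 1 := by
              rwa [Ne, SimpleGraph.dist_eq_one_iff_adj]
            have h8 : H.graph.dist z' s ≠ 0 := by
              rw [Ne, hH.dist_eq_zero]
              rintro rfl; exact hadj h1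
            omega
          obtain ⟨h1, h2, -⟩ := key s₁ q₁.2 hs1 hs2 hq₁.2
          obtain ⟨h3, h4, -⟩ := key s₂ q₂.2 hs3 hs4 hq₂.2
          obtain rfl := hH.eq_of_dist hs1 hs3 h1 h3
          exact hne (hH.eq_of_dist hs2.symm hs4.symm h2 h4)
        obtain ⟨q, hq, hcom⟩ := hcommon
        have hqQ : q ∈ q₁ :: q₂ :: Q' := by
          simp only [List.mem_cons, List.not_mem_nil, or_false] at hq ⊢; tauto
        refine Wins.mono (r := r + 1) (L := [(y, y'), q]) ?_ le_rfl (by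
          intro p hp
          simp only [List.mem_cons, List.not_mem_nil, or_false] at hp ⊢
          rcases hp with rfl | rfl
          · simp
          · exact .inr (by simpa using hqQ))
        refine Wins.step (by simp; omega) z fun s => ?_
        by_cases hs : H.graph.Adj s y'
        · exact .of_adj (x := z) (x' := s) (y := q.1) (y' := q.2) (by simp) (by simp)
            (by simp [(hQ q hqQ).1, hcom s hs])
        · exact .of_adj (x := z) (x' := s) (y := y) (y' := y') (by simp) (by simp)
            (by simp [hzy, hs])

/-- Spoiler wins if `z` has a set `D` of neighbors that is larger than the set `E` of the
vertices that would be good responses. -/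
theorem wins_of_card_lt [Finite W] (hk : 3 ≤ k) (hG : G.IsTree) (hH : H.IsTree) {z : V} {z' : W}
    (Q : List (V × W)) (hQ : ∀ q ∈ Q, G.graph.Adj z q.1 ∧ H.graph.Adj z' q.2)
    (hn1 : (Q.map Prod.fst).Nodup) (hn2 : (Q.map Prod.snd).Nodup) (D : Finset V) (E : Finset W)
    (hD : ∀ y ∈ D, G.graph.Adj z y ∧ y ∉ Q.map Prod.fst) (hcard : E.card < D.card)
    (hlen : Q.length + E.card + 1 ≤ k)
    (h : ∀ x ∈ D, ∀ x', H.graph.Adj z' x' → x' ∉ Q.map Prod.snd → x' ∉ E →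
      Wins k G H r [(z, z'), (x, x')]) :
    Wins k G H (r + E.card + 2) ((z, z') :: Q) := by
  classical
  -- Pigeonhole: distinct answers to `E.card + 1` pebbles cannot all lie in `E`.
  obtain ⟨Y, hYD, hY⟩ := Finset.exists_subset_card_eq (Nat.succ_le_of_lt hcard)
  have hnd : (Q.map Prod.fst ++ Y.toList).Nodup := by
    refine List.Nodup.append hn1 Y.nodup_toList fun y h1 h2 => ?_
    exact (hD y (hYD (Finset.mem_toList.1 h2))).2 h1
  have := wins_of_neighbors hk hG hH (r := r) Y.toList Q hQ hnd hn2
    (fun y hy => (hD y (hYD (Finset.mem_toList.1 hy))).1) (by simp [hY]; omega) (by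
      intro P hQP hperm hsnd hP
      by_contra! hcon
      have hfst : (P.map Prod.fst).Nodup := hperm.nodup_iff.2 hnd
      have hmem : ∀ y ∈ Y, ∃ y', (y, y') ∈ P := fun y hy => by
        have : y ∈ P.map Prod.fst := hperm.mem_iff.2 (by simp [hy])
        obtain ⟨q, hq, rfl⟩ := List.mem_map.1 this
        exact ⟨q.2, hq⟩
      have : Nonempty W := hH.nonempty
      choose! f hf using hmem
      refine absurd (Finset.card_le_card_of_injOn f (s := Y) (t := E) ?_ ?_) (by omega)
      · intro y hy
        by_contra hyE
        refine hcon _ (hf y hy) (h y (hYD hy) (f y) (hP _ (hf y hy)).2 ?_ hyE)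
        intro hfy
        obtain ⟨q, hq, hqy⟩ := List.mem_map.1 hfy
        have := List.inj_on_of_nodup_map hsnd (hQP hq) (hf y hy) hqy
        exact (hD y (hYD hy)).2 (List.mem_map.2 ⟨q, hq, by rw [this]⟩)
      · intro y hy x hx hxy
        have := List.inj_on_of_nodup_map hsnd (hf y hy) (hf x hx) hxy
        exact congrArg Prod.fst this)
  refine this.mono (by simp [hY]; omega) (List.Subset.refl _)

end ColoredGraph

/-! ### Spoiler at a vertex where the types change -/

namespace ColoredGraph

variable {C V W : Type*} [Fintype V] [Fintype W] {k r : ℕ} {G : ColoredGraph C V}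
  {H : ColoredGraph C W} {L : List (V × W)}

/-- Adjacency to `z'` and the distance from `a'` single out the correct answer; any other one loses
by adjacency or by comparison of distances. -/
theorem wins_of_par {V W : Type*} [Finite V] [Finite W] {G : ColoredGraph C V}
    {H : ColoredGraph C W} {L : List (V × W)} (hk : 3 ≤ k) (hG : G.IsTree) (hH : H.IsTree)
    {a z : V} {a' z' : W} (ha : (a, a') ∈ L) (hz : (z, z') ∈ L) (haz : a ≠ z)
    (hd : G.graph.dist a z = H.graph.dist a' z') (hr : G.graph.dist a z ≤ 2 ^ r)
    (h : Wins k G H r [(z, z'), (G.graph.par a z, H.graph.par a' z')]) :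
    Wins k G H (r + 1) L := by
  have := hH.nonempty
  have h1 := hG.dist_par haz
  refine Wins.mono (L := [(z, z'), (a, a')]) ?_ le_rfl (by simp [ha, hz])
  refine Wins.step (by simp; omega) (G.graph.par a z) fun u' => ?_
  by_cases hadj : H.graph.Adj u' z'
  · by_cases hdu : G.graph.dist a (G.graph.par a z) = H.graph.dist a' u'
    · rw [hH.eq_par (a := a') hadj (by omega)]
      exact h.mono le_rfl (by simp)
    · exact wins_of_dist_ne hk hG hH (x := a) (x' := a') (y := G.graph.par a z) (y' := u')
        (by simp) (by simp) (by omega) hdu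
  · exact .of_adj (x := G.graph.par a z) (x' := u') (y := z) (y' := z') (by simp) (by simp)
      (by simp [hG.adj_par haz, hadj])

/-- The situation in which the types of the branches at `z` and `z'` differ although the neighbors
towards the root cannot be distinguished from those children that might be responsible for that:
then some other type distinguishes `z` from `z'`. -/
theorem exists_type_of_ne (hG : G.IsTree) (hH : H.IsTree)
    (hno : ∀ z z', G.branchType k z z ≠ H.branchType k z' z') {u z : V} {u' z' : W}
    (hu : G.graph.Adj u z) (hu' : H.graph.Adj u' z')
    (hne : G.branchType k u z ≠ H.branchType k u' z') (hc : G.color z = H.color z') :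
    ∃ σ, min k (G.kidCount k u z σ) ≠ min k (H.kidCount k u' z' σ) ∧
      (min (G.kidCount k u z σ) (H.kidCount k u' z' σ) + 2 ≤ k ∨
        ¬ (G.branchType k z u = σ ∧ H.branchType k z' u' = σ)) := by
  classical
  by_contra! hcon
  obtain ⟨σ, hσ⟩ : ∃ σ, min k (G.kidCount k u z σ) ≠ min k (H.kidCount k u' z' σ) := by
    by_contra! h
    exact hne ((branchType_eq_iff hG hH (.inl hu) (.inl hu')).2 ⟨hc, h⟩)
  have hA := (hcon σ hσ).2
  -- Otherwise every type with different capped counts is the type of both upward branches and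
  -- occurs at least `k - 1` times on both sides. Counting the upward neighbors lifts both counts to
  -- the cap, so the rooted types would agree.
  refine hno z z' ((branchType_eq_iff hG hH (.inr rfl) (.inr rfl)).2 ⟨hc, fun τ => ?_⟩)
  rw [kidCount_self hu, kidCount_self hu', hA.1, hA.2]
  by_cases hτ : min k (G.kidCount k u z τ) = min k (H.kidCount k u' z' τ)
  · split_ifs <;> omega
  · obtain ⟨h1, h2, -⟩ := hcon τ hτ
    rw [hA.1] at h2
    rw [if_pos h2]
    omega

open Classical in
-- The pebble on `u` keeps the upward branch out of the count; it costs one pebble, hence the bound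
-- `k - 2` on the smaller count.
theorem wins_of_kidCount_lt {V W : Type*} [Fintype V] [Fintype W] {G : ColoredGraph C V}
    {H : ColoredGraph C W} (hk : 3 ≤ k) (hG : G.IsTree) (hH : H.IsTree) {u z : V} {u' z' : W}
    (hu : G.graph.Adj u z) (hu' : H.graph.Adj u' z') {σ : ColoredBranch C}
    (hlt : G.kidCount k u z σ < H.kidCount k u' z' σ) (hck : G.kidCount k u z σ + 2 ≤ k)
    (h : ∀ x ∈ G.graph.kids u z, ∀ x' ∈ H.graph.kids u' z', G.branchType k z x ≠ σ →
      H.branchType k z' x' = σ → Wins k G H r [(z, z'), (x, x')]) :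
    Wins k G H (r + k) [(z, z'), (u, u')] := by
  have := wins_of_card_lt hk hH hG (r := r) (z := z') (z' := z) [(u', u)]
    (by simp [hu.symm, hu'.symm]) (by simp) (by simp)
    ((H.graph.kids u' z').filter fun x => H.branchType k z' x = σ)
    ((G.graph.kids u z).filter fun x => G.branchType k z x = σ)
    (fun y hy => by
      obtain ⟨h1, -⟩ := Finset.mem_filter.1 hy
      simpa using SimpleGraph.mem_kids.1 h1) hlt
    (by simp only [List.length_singleton]; rw [kidCount] at hck; omega)
    (fun x hx x' hadj hxu hxE => by
      obtain ⟨h1, h2⟩ := Finset.mem_filter.1 hx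
      have h3 : x' ∈ G.graph.kids u z := SimpleGraph.mem_kids.2 ⟨hadj, by simpa using hxu⟩
      exact (h x' h3 x h1 (fun e => hxE (Finset.mem_filter.2 ⟨h3, e⟩)) h2).swap)
  refine (this.swap).mono ?_ (by simp)
  rw [kidCount] at hck
  omega

open Classical in
-- All neighbors are counted, so no pebble is needed on the parent and the smaller count may be as
-- large as `k - 1`.
theorem wins_of_kidCount_self_lt {V W : Type*} [Fintype V] [Fintype W] {G : ColoredGraph C V}
    {H : ColoredGraph C W} (hk : 3 ≤ k) (hG : G.IsTree) (hH : H.IsTree) {z : V} {z' : W}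
    {σ : ColoredBranch C}
    (hlt : G.kidCount k z z σ < H.kidCount k z' z' σ) (hck : G.kidCount k z z σ < k)
    (h : ∀ x, G.graph.Adj z x → ∀ x', H.graph.Adj z' x' → G.branchType k z x ≠ σ →
      H.branchType k z' x' = σ → Wins k G H r [(z, z'), (x, x')]) :
    Wins k G H (r + G.kidCount k z z σ + 2) [(z, z')] := by
  have := wins_of_card_lt hk hH hG (r := r) (z := z') (z' := z) []
    (by simp) (by simp) (by simp)
    ((H.graph.kids z' z').filter fun x => H.branchType k z' x = σ)
    ((G.graph.kids z z).filter fun x => G.branchType k z x = σ)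
    (fun y hy => by
      obtain ⟨h1, -⟩ := Finset.mem_filter.1 hy
      simpa using SimpleGraph.mem_kids_self.1 h1) hlt
    (by simp only [List.length_nil]; rw [kidCount] at hck; omega)
    (fun x hx x' hadj _ hxE => by
      obtain ⟨h1, h2⟩ := Finset.mem_filter.1 hx
      exact (h x' hadj x (SimpleGraph.mem_kids_self.1 h1)
        (fun e => hxE (Finset.mem_filter.2 ⟨SimpleGraph.mem_kids_self.2 hadj, e⟩)) h2).swap)
  exact (this.swap).mono le_rfl (by simp)

theorem exists_ne_of_two_le_kidCount {u z : V} {σ : ColoredBranch C}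
    (h : 2 ≤ G.kidCount k u z σ) (v : V) :
    ∃ y ∈ G.graph.kids u z, y ≠ v ∧ G.branchType k z y = σ := by
  classical
  obtain ⟨y, hy, hyv⟩ := Finset.exists_mem_ne (Nat.lt_of_succ_le h) v
  exact ⟨y, (Finset.mem_filter.1 hy).1, hyv, (Finset.mem_filter.1 hy).2⟩

/-- Spoiler's strategy at a vertex `z` where the type of a branch changes: if the types in `Sm` can
be handled in `r` rounds, and all children of `z` except possibly `v` have such a type, then `k + 1`
additional rounds suffice. -/
theorem wins_of_branchType_ne_at (hk : 3 ≤ k) (hG : G.IsTree) (hH : H.IsTree)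
    (hno : ∀ z z', G.branchType k z z ≠ H.branchType k z' z') {a z : V} {a' z' : W}
    (ha : (a, a') ∈ L) (hz : (z, z') ∈ L) (haz : a ≠ z)
    (hd : G.graph.dist a z = H.graph.dist a' z') (hr : G.graph.dist a z ≤ 2 ^ r)
    (hne : G.branchType k (G.graph.par a z) z ≠ H.branchType k (H.graph.par a' z') z')
    (Sm : ColoredBranch C → Prop)
    (hSm : ∀ x x', G.graph.Adj z x → H.graph.Adj z' x' →
      G.branchType k z x ≠ H.branchType k z' x' →
      Sm (G.branchType k z x) ∨ Sm (H.branchType k z' x') → Wins k G H r [(z, z'), (x, x')])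
    (v : V) (hv : ∀ x ∈ G.graph.kids (G.graph.par a z) z, x ≠ v → Sm (G.branchType k z x))
    (hB : v ∈ G.graph.kids (G.graph.par a z) z → Sm (G.branchType k z v) ∨
      ∃ v' ∈ H.graph.kids (H.graph.par a' z') z', H.branchType k z' v' = G.branchType k z v)
    (hsp : ∀ x' ∈ H.graph.kids (H.graph.par a' z') z',
      G.kidCount k (G.graph.par a z) z (H.branchType k z' x') = 0 →
      (∀ x ∈ G.graph.kids (G.graph.par a z) z, Sm (G.branchType k z x)) ∨
        Wins k G H (r + k + 1) L) :
    Wins k G H (r + k + 1) L := by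
  by_cases hc : G.color z = H.color z'
  swap
  · exact .of_color hz hc
  have haz' : a' ≠ z' := by
    intro e; subst e
    exact haz (hG.dist_eq_zero.1 (by simpa using hd))
  have hu := hG.adj_par haz
  have hu' := hH.adj_par haz'
  have hpar : ∀ {s}, r ≤ s → s ≤ r + k →
      Wins k G H s [(z, z'), (G.graph.par a z, H.graph.par a' z')] → Wins k G H (r + k + 1) L :=
    fun {s} h1 h2 h => (wins_of_par hk hG hH ha hz haz hd
      (hr.trans (Nat.pow_le_pow_right (by omega) h1)) h).mono (by omega) (List.Subset.refl _)
  have hkid : ∀ x ∈ G.graph.kids (G.graph.par a z) z, G.graph.Adj z x := fun x hx =>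
    (SimpleGraph.mem_kids.1 hx).1
  have hkid' : ∀ x ∈ H.graph.kids (H.graph.par a' z') z', H.graph.Adj z' x := fun x hx =>
    (SimpleGraph.mem_kids.1 hx).1
  obtain ⟨σ, hσ, hgood⟩ := exists_type_of_ne hG hH hno hu hu' hne hc
  have hSm2 : 2 ≤ G.kidCount k (G.graph.par a z) z σ → Sm σ := fun h => by
    obtain ⟨y, hy, hyv, rfl⟩ := exists_ne_of_two_le_kidCount h v
    exact hv y hy hyv
  by_cases hcase : min (G.kidCount k (G.graph.par a z) z σ)
      (H.kidCount k (H.graph.par a' z') z' σ) + 2 ≤ k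
  · rcases lt_trichotomy (G.kidCount k (G.graph.par a z) z σ)
      (H.kidCount k (H.graph.par a' z') z' σ) with hlt | heq | hlt
    · have hmain : (∀ x ∈ G.graph.kids (G.graph.par a z) z, G.branchType k z x ≠ σ →
          Sm (G.branchType k z x) ∨ Sm σ) → Wins k G H (r + k + 1) L := fun hsm =>
        hpar (Nat.le_add_right _ _) le_rfl <|
          wins_of_kidCount_lt hk hG hH hu hu' hlt (by omega) fun x hx x' hx' hxσ hxσ' =>
            hSm x x' (hkid x hx) (hkid' x' hx') (by rwa [hxσ']) (by rw [hxσ']; exact hsm x hx hxσ)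
      rcases Nat.eq_zero_or_pos (G.kidCount k (G.graph.par a z) z σ) with h0 | h0
      · obtain ⟨x', hx', rfl⟩ := exists_of_kidCount_pos (lt_of_le_of_lt (Nat.zero_le _) hlt)
        rcases hsp x' hx' h0 with hsp | hsp
        · exact hmain fun x hx _ => .inl (hsp x hx)
        · exact hsp
      · obtain ⟨y, hy, hyσ⟩ := exists_of_kidCount_pos h0
        refine hmain fun x hx hxσ => ?_
        -- If `v` has type `σ`, then children of other types differ from `v` and are small;
        -- otherwise `σ` itself is small.
        by_cases hyv : y = v
        · refine .inl (hv x hx ?_)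
          rintro rfl
          exact hxσ (hyv ▸ hyσ)
        · exact .inr (hyσ ▸ hv y hy hyv)
    · exact (hσ (by rw [heq])).elim
    · have hsm : Sm σ := by
        obtain ⟨y, hy, hyσ⟩ := exists_of_kidCount_pos (lt_of_le_of_lt (Nat.zero_le _) hlt)
        by_cases hyv : y = v
        · subst hyv
          rcases hB hy with h | ⟨v', hv', h⟩
          · rwa [hyσ] at h
          · have := kidCount_pos (k := k) hv'
            rw [h, hyσ] at this
            exact hSm2 (by omega)
        · exact hyσ ▸ hv y hy hyv
      have hck : H.kidCount k (H.graph.par a' z') z' σ + 2 ≤ k := by omega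
      refine hpar (Nat.le_add_right _ _) le_rfl <| .of_swap <|
        wins_of_kidCount_lt hk hH hG hu' hu hlt hck fun x hx x' hx' hxσ hxσ' => ?_
      exact (hSm x' x (hkid x' hx') (hkid' x hx) (by rw [hxσ']; exact hxσ.symm)
        (by rw [hxσ']; exact .inl hsm)).swap
  -- Both counts are at least `k - 1 ≥ 2`, so `σ` occurs at a child other than `v`. If exactly one
  -- upward branch has type `σ`, Spoiler moves to the parents; if neither has, counting all
  -- neighbors gives the same numbers without a pebble on the parent.
  · have hsm : Sm σ := hSm2 (by omega)
    by_cases h1 : G.branchType k z (G.graph.par a z) = σ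
    · have h2 : H.branchType k z' (H.graph.par a' z') ≠ σ := fun h2 =>
        (hgood.resolve_left hcase) ⟨h1, h2⟩
      exact hpar le_rfl (Nat.le_add_right _ _) <|
        hSm _ _ hu.symm hu'.symm (by rw [h1]; exact h2.symm) (by rw [h1]; exact .inl hsm)
    · by_cases h2 : H.branchType k z' (H.graph.par a' z') = σ
      · exact hpar le_rfl (Nat.le_add_right _ _) <|
          hSm _ _ hu.symm hu'.symm (by rwa [h2]) (by rw [h2]; exact .inr hsm)
      · have h3 := kidCount_self (k := k) hu σ
        have h4 := kidCount_self (k := k) hu' σ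
        rw [if_neg h1, add_zero] at h3
        rw [if_neg h2, add_zero] at h4
        rw [← h3, ← h4] at hσ hcase
        rcases Nat.lt_or_gt_of_ne (show G.kidCount k z z σ ≠ H.kidCount k z' z' σ from
          fun e => hσ (by rw [e])) with hlt | hlt
        · refine (wins_of_kidCount_self_lt (r := r) hk hG hH hlt (by omega)
            fun x hx x' hx' hxσ hxσ' => ?_).mono (by omega) (by simp [hz])
          exact hSm x x' hx hx' (by rwa [hxσ']) (by rw [hxσ']; exact .inr hsm)
        · refine .of_swap <| (wins_of_kidCount_self_lt (r := r) hk hH hG hlt (by omega)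
            fun x hx x' hx' hxσ hxσ' => ?_).mono (by omega) (by
              simpa using hz)
          exact (hSm x' x hx' hx (by rw [hxσ']; exact hxσ.symm)
            (by rw [hxσ']; exact .inl hsm)).swap

end ColoredGraph

/-! ### Binary search along a path -/

namespace ColoredGraph

variable {C V W : Type*} [Fintype V] [Fintype W] {k r : ℕ} {G : ColoredGraph C V}
  {H : ColoredGraph C W} {L : List (V × W)}

/-- Spoiler wins in a number of rounds logarithmic in `n` from all positions in which two branches
of different types are pebbled and one of the types has size `n`. -/
def BranchWins (k : ℕ) (G : ColoredGraph C V) (H : ColoredGraph C W) (n : ℕ) : Prop :=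
  ∀ b w b' w', G.graph.Adj b w → H.graph.Adj b' w' →
    G.branchType k b w ≠ H.branchType k b' w' →
    (G.branchType k b w).size = n ∨ (H.branchType k b' w').size = n →
    Wins k G H ((k + 3) * Nat.log 2 n + 1) [(b, b'), (w, w')]

theorem BranchWins.symm {n : ℕ} (h : BranchWins k G H n) : BranchWins k H G n :=
  fun b w b' w' hb hb' hne hn => (h b' w' b w hb' hb hne.symm hn.symm).swap

theorem wins_of_forall_branchWins {n : ℕ} (h : ∀ m ≤ n, BranchWins k G H m) {x z : V} {x' z' : W}
    (hx : G.graph.Adj z x) (hx' : H.graph.Adj z' x')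
    (hne : G.branchType k z x ≠ H.branchType k z' x')
    (hs : (G.branchType k z x).size ≤ n ∨ (H.branchType k z' x').size ≤ n) :
    Wins k G H ((k + 3) * Nat.log 2 n + 1) [(z, z'), (x, x')] := by
  rcases hs with hs | hs
  · exact (h _ hs z x z' x' hx hx' hne (.inl rfl)).mono (by gcongr) (List.Subset.refl _)
  · exact (h _ hs z x z' x' hx hx' hne (.inr rfl)).mono (by gcongr) (List.Subset.refl _)

/-- The cap is at least two, so both children survive in the type even if their types coincide. -/
theorem size_add_size_lt {V : Type*} [Fintype V] {G : ColoredGraph C V} (hG : G.IsTree)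
    (hk : 2 ≤ k) {b w x y : V} (h : G.graph.Adj b w)
    (hx : x ∈ G.graph.kids b w) (hy : y ∈ G.graph.kids b w) (hxy : x ≠ y) :
    (G.branchType k w x).size + (G.branchType k w y).size < (G.branchType k b w).size := by
  classical
  rw [size_branchType hG (.inl h)]
  have hle : ({G.branchType k w x, G.branchType k w y} : Multiset (ColoredBranch C)) ≤
      ((G.graph.kids b w).val.map (G.branchType k w)).truncate k := by
    rw [Multiset.le_iff_count]
    intro σ
    rw [Multiset.count_truncate]
    refine le_min ((Multiset.count_le_card _ _).trans (by simpa using hk)) ?_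
    refine Multiset.count_le_of_le σ ?_
    have : ({x, y} : Multiset V) ≤ (G.graph.kids b w).val := by
      rw [Multiset.le_iff_subset (by simpa using hxy)]
      intro z hz
      simp only [Multiset.insert_eq_cons, Multiset.mem_cons, Multiset.mem_singleton] at hz
      rcases hz with rfl | rfl <;> assumption
    exact Multiset.map_le_map this
  obtain ⟨u, hu⟩ := Multiset.le_iff_exists_add.1 (Multiset.map_le_map (f := ColoredBranch.size) hle)
  rw [hu, Multiset.sum_add]
  simp
  omega

theorem par_mem_kids {V : Type*} [Fintype V] {G : SimpleGraph V} (hG : G.IsTree) {a t z : V}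
    (hz : G.dist a z + G.dist z t = G.dist a t) (hzt : z ≠ t) :
    G.par t z ∈ G.kids (G.par a z) z := by
  obtain ⟨h1, h2, h3⟩ := hG.dist_step hz hzt
  rw [hG.mem_kids_par]
  exact ⟨by rintro h; rw [h] at h1; simp at h1, h3⟩

/-- Each step down the path loses at least one vertex of the type. Distances are thus bounded by
size differences, which makes comparing them affordable. -/
theorem size_add_dist_le {V : Type*} [Fintype V] {G : ColoredGraph C V} (hG : G.IsTree)
    (hk : 0 < k) {a t z : V} (hza : z ≠ a) (hzt : z ≠ t)
    (hz : G.graph.dist a z + G.graph.dist z t = G.graph.dist a t) :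
    (G.branchType k (G.graph.par a t) t).size + G.graph.dist z t ≤
      (G.branchType k (G.graph.par a z) z).size := by
  induction hn : G.graph.dist z t generalizing z with
  | zero => exact (hzt (hG.dist_eq_zero.1 hn)).elim
  | succ n ih =>
    obtain ⟨h1, h2, h3⟩ := hG.dist_step hz hzt
    have h4 := size_branchType_lt hG hk (.inl (hG.adj_par hza.symm)) (par_mem_kids hG hz hzt)
    by_cases ht : G.graph.par t z = t
    · rw [ht] at h2 h3 h4
      rw [h3]
      simp only [SimpleGraph.dist_self] at h2
      omega
    · have := ih (z := G.graph.par t z) (by rintro h; rw [h] at h1; simp at h1) ht (by omega)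
        (by omega)
      rw [h3] at this
      omega

theorem size_add_dist_le' {V : Type*} [Fintype V] {G : ColoredGraph C V} (hG : G.IsTree)
    (hk : 0 < k) {a t : V} (hat : a ≠ t) :
    (G.branchType k (G.graph.par a t) t).size + G.graph.dist a t ≤
      (G.branchType k a (G.graph.par t a)).size + 1 := by
  have h0 : G.graph.dist a a + G.graph.dist a t = G.graph.dist a t := by simp
  obtain ⟨h1, h2, h3⟩ := hG.dist_step h0 hat
  rw [SimpleGraph.dist_self] at h1
  by_cases ht : G.graph.par t a = t
  · rw [ht] at h1 h3 ⊢
    rw [h3]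
    omega
  · have := size_add_dist_le hG hk (a := a) (t := t) (z := G.graph.par t a)
      (by rintro h; rw [h] at h1; simp at h1) ht (by omega)
    rw [h3] at this
    omega

theorem lt_two_pow_mul_log (n : ℕ) {c : ℕ} (hc : 0 < c) : n < 2 ^ (c * Nat.log 2 n + 1) := by
  refine (Nat.lt_pow_succ_log_self Nat.one_lt_two n).trans_le ?_
  exact Nat.pow_le_pow_right (by omega) (Nat.succ_le_succ (Nat.le_mul_of_pos_left _ hc))

/-- Spoiler's binary search for a change of types on the path between the pebbled vertices. -/
theorem wins_of_segment (hk : 3 ≤ k) (hG : G.IsTree) (hH : H.IsTree)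
    (hno : ∀ z z', G.branchType k z z ≠ H.branchType k z' z') (M : ℕ)
    (hM : ∀ n ≤ M, BranchWins k G H n) {a t : V} {a' t' : W} (hat : a ≠ t)
    (hd : G.graph.dist a t = H.graph.dist a' t')
    (htop : G.branchType k a (G.graph.par t a) ≠ H.branchType k a' (H.graph.par t' a'))
    (hbot : G.branchType k (G.graph.par a t) t = H.branchType k (H.graph.par a' t') t')
    (hsize : (G.branchType k a (G.graph.par t a)).size ≤
      (G.branchType k (G.graph.par a t) t).size + M) :
    Wins k G H ((k + 3) * Nat.log 2 M + k + 3) [(a, a'), (t, t')] := by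
  classical
  have := hH.nonempty
  induction M using Nat.strong_induction_on generalizing a t a' t' with
  | _ M ih =>
    have hat' : a' ≠ t' := by
      rintro rfl; exact hat (hG.dist_eq_zero.1 (by simpa using hd))
    have hdist2 : ∀ {a t : V} {a' t' : W}, a ≠ t → G.graph.dist a t = H.graph.dist a' t' →
        G.branchType k a (G.graph.par t a) ≠ H.branchType k a' (H.graph.par t' a') →
        G.branchType k (G.graph.par a t) t = H.branchType k (H.graph.par a' t') t' →
        2 ≤ G.graph.dist a t := by
      intro a t a' t' hat hd htop hbot
      have h0 := hG.dist_pos hat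
      by_contra hlt
      have h1 : G.graph.Adj a t := SimpleGraph.dist_eq_one_iff_adj.1 (by omega)
      have h2 : H.graph.Adj a' t' := SimpleGraph.dist_eq_one_iff_adj.1 (by omega)
      rw [hG.par_of_adj h1, hH.par_of_adj h2] at hbot
      rw [hG.par_of_adj h1.symm, hH.par_of_adj h2.symm] at htop
      exact htop hbot
    have hd2 := hdist2 hat hd htop hbot
    have hpath := size_add_dist_le' hG (by omega : 0 < k) hat
    -- Halving the size difference frees `k + 3` rounds, more than enough for the round spent on
    -- `z`.
    have hrec : ∀ {a t : V} {a' t' : W}, a ≠ t → G.graph.dist a t = H.graph.dist a' t' →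
        G.branchType k a (G.graph.par t a) ≠ H.branchType k a' (H.graph.par t' a') →
        G.branchType k (G.graph.par a t) t = H.branchType k (H.graph.par a' t') t' →
        2 * (G.branchType k a (G.graph.par t a)).size ≤
          2 * (G.branchType k (G.graph.par a t) t).size + M →
        Wins k G H ((k + 3) * Nat.log 2 M + k + 2) [(a, a'), (t, t')] := by
      intro a t a' t' hat hd htop hbot hs
      have h2 := hdist2 hat hd htop hbot
      have hp := size_add_dist_le' hG (by omega : 0 < k) hat
      have hlog : Nat.log 2 M = Nat.log 2 (M / 2) + 1 := by
        rw [Nat.log_div_base]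
        have : 0 < Nat.log 2 M := Nat.log_pos Nat.one_lt_two (by omega)
        omega
      refine (ih (M / 2) (by omega) (fun n hn => hM n (by omega)) hat hd htop hbot
        (by omega)).mono ?_ (List.Subset.refl _)
      rw [hlog, mul_add]
      omega
    -- the vertex at which the search continues
    let s : Finset V := {z | z ≠ a ∧ z ≠ t ∧
      G.graph.dist a z + G.graph.dist z t = G.graph.dist a t ∧
      2 * (G.branchType k a (G.graph.par t a)).size ≤
        2 * (G.branchType k (G.graph.par a z) z).size + M}
    have hs : s.Nonempty := by
      obtain ⟨h1, h2, h3⟩ := hG.dist_step (a := a) (z := a) (t := t) (by simp) hat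
      rw [SimpleGraph.dist_self] at h1
      refine ⟨G.graph.par t a, ?_⟩
      simp only [s, Finset.mem_filter, Finset.mem_univ, true_and]
      refine ⟨?_, ?_, by omega, ?_⟩
      · intro h; rw [h] at h1; simp at h1
      · intro h; rw [h] at h2; simp at h2; omega
      · rw [h3]; omega
    -- The deepest vertex whose type size is within `M / 2` of the top one. The difference from the
    -- top down to `z` is at most `M / 2`, and so is the one from the vertex after `z` down to the
    -- bottom.
    obtain ⟨z, hzs, hmax⟩ := s.exists_max_image (G.graph.dist a) hs
    simp only [s, Finset.mem_filter, Finset.mem_univ, true_and] at hzs hmax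
    obtain ⟨hza, hzt, hz, hzM⟩ := hzs
    refine Wins.step (r := (k + 3) * Nat.log 2 M + k + 2) (by simp; omega) z fun z' => ?_
    have hpow : M < 2 ^ ((k + 3) * Nat.log 2 M + 1) := lt_two_pow_mul_log M (by omega)
    have hpow2 : M + 1 ≤ 2 ^ ((k + 3) * Nat.log 2 M + 2) := by
      rw [pow_succ]; omega
    have hpow3 : M ≤ 2 ^ ((k + 3) * Nat.log 2 M + k + 2) :=
      hpow.le.trans (Nat.pow_le_pow_right (by omega) (by omega))
    have hza0 := hG.dist_pos hza.symm
    have hzt0 := hG.dist_pos hzt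
    by_cases hd1 : G.graph.dist a z = H.graph.dist a' z'
    swap
    · exact wins_of_dist_ne hk hG hH (x := a) (x' := a') (y := z) (y' := z') (by simp) (by simp)
        (le_trans (by omega) hpow3) hd1
    by_cases hd2 : G.graph.dist z t = H.graph.dist z' t'
    swap
    · exact wins_of_dist_ne hk hG hH (x := z) (x' := z') (y := t) (y' := t') (by simp) (by simp)
        (le_trans (by omega) hpow3) hd2
    have hz' : H.graph.dist a' z' + H.graph.dist z' t' = H.graph.dist a' t' := by omega
    have hza' : z' ≠ a' := by rintro rfl; simp at hd1; omega
    have hzt' : z' ≠ t' := by rintro rfl; simp at hd2; omega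
    obtain ⟨hv1, hv2, hv3⟩ := hG.dist_step hz hzt
    obtain ⟨hv1', hv2', hv3'⟩ := hH.dist_step hz' hzt'
    by_cases hlow : G.branchType k z (G.graph.par t z) = H.branchType k z' (H.graph.par t' z')
    swap
    · have hp := hG.par_eq_of_dist hz hzt
      have hp' := hH.par_eq_of_dist hz' hzt'
      refine (hrec hzt hd2 hlow (by rw [hp, hp', hbot]) ?_).mono le_rfl
        (by intro q; simp only [List.mem_cons]; tauto)
      by_cases hvt : G.graph.par t z = t
      · rw [hvt] at hv3 ⊢
        rw [hp, hv3]
        omega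
      · by_contra hcon
        rw [hp] at hcon
        have := hmax (G.graph.par t z) ⟨by intro h; rw [h] at hv1; simp at hv1, hvt, by omega, by
          rw [hv3]; omega⟩
        omega
    by_cases hup : G.branchType k (G.graph.par a z) z = H.branchType k (H.graph.par a' z') z'
    · have hp := hG.par_eq_of_dist' hz hza
      have hp' := hH.par_eq_of_dist' hz' hza'
      refine (hrec hza.symm hd1 (by rw [hp, hp']; exact htop) hup (by rw [hp]; exact hzM)).mono
        le_rfl (by intro q; simp only [List.mem_cons]; tauto)
    have hsz := size_add_dist_le hG (by omega : 0 < k) hza hzt hz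
    have hsz1 : (G.branchType k (G.graph.par a z) z).size ≤
        (G.branchType k a (G.graph.par t a)).size := by
      have := size_add_dist_le' hG (by omega : 0 < k) hza.symm
      rw [hG.par_eq_of_dist' hz hza] at this
      omega
    have hsz2 : (G.branchType k (G.graph.par a t) t).size ≤
        (G.branchType k z (G.graph.par t z)).size := by
      have := size_add_dist_le' hG (by omega : 0 < k) hzt
      rw [hG.par_eq_of_dist hz hzt] at this
      omega
    have hvk := par_mem_kids hG hz hzt
    have hvk' := par_mem_kids hH hz' hzt'
    -- The type at `z` exceeds that of its child on the path by at most `M`, and the other children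
    -- must fit into this difference.
    have hsmall : ∀ x ∈ G.graph.kids (G.graph.par a z) z, x ≠ G.graph.par t z →
        (G.branchType k z x).size ≤ M := by
      intro x hx hxv
      have := size_add_size_lt (k := k) hG (by omega) (hG.adj_par hza.symm) hx hvk hxv
      omega
    have key := wins_of_branchType_ne_at (L := [(z, z'), (a, a'), (t, t')])
      (r := (k + 3) * Nat.log 2 M + 1) hk hG hH hno (a := a) (a' := a') (z := z) (z' := z')
      (by simp) (by simp) hza.symm hd1 (le_trans (by omega) hpow) hup (fun σ => σ.size ≤ M)
      (fun x x' hx hx' hne hs => wins_of_forall_branchWins hM hx hx' hne hs)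
      (G.graph.par t z) hsmall (fun _ => .inr ⟨_, hvk', hlow.symm⟩)
    refine (key fun x' hx' h0 => .inr ?_).mono (by omega) (List.Subset.refl _)
    -- a child of `z'` off the path that has no counterpart at `z`
    have hxv' : x' ≠ H.graph.par t' z' := by
      rintro rfl
      have := kidCount_pos (k := k) hvk
      rw [hlow] at this
      omega
    obtain ⟨hadj', hxu'⟩ := SimpleGraph.mem_kids.1 hx'
    have hxa' := hH.dist_of_ne_par hadj' hxu'
    have hxt' := hH.dist_of_ne_par hadj' hxv'
    have hpx' := hH.par_of_ne_par hadj' hxu'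
    have hV := hG.nonempty
    -- The pebble on `z` is released so that three pebbles suffice. The distances to `a` and `t`
    -- force the answer to be a child of `z`, and `wins_of_par` then pebbles `z` again.
    refine Wins.mono (r := (k + 3) * Nat.log 2 M + 1 + 1 + 1) (L := [(a, a'), (t, t')]) ?_
      (by omega) (List.subset_cons_self _ _)
    refine Wins.step' (by simp; omega) x' fun x => ?_
    by_cases hxa : H.graph.dist a' x' = G.graph.dist a x
    swap
    · refine .of_swap <| wins_of_dist_ne hk hH hG (x := a') (x' := a) (y := x') (y' := x)
        (by simp) (by simp) (le_trans (by omega) hpow2) hxa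
    by_cases hxt : H.graph.dist t' x' = G.graph.dist t x
    swap
    · refine .of_swap <| wins_of_dist_ne hk hH hG (x := t') (x' := t) (y := x') (y' := x)
        (by simp) (by simp) (le_trans (by
          rw [SimpleGraph.dist_comm (u := t') (v := z')] at hxt'; omega) hpow2) hxt
    rw [SimpleGraph.dist_comm (u := t) (v := x)] at hxt
    rw [SimpleGraph.dist_comm (u := t') (v := z')] at hxt'
    have hpx : G.graph.par a x = z := hG.par_eq_of_between hz (by omega) (by omega)
    have hax : a ≠ x := by rintro rfl; rw [SimpleGraph.dist_self] at hxa; omega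
    have hxk : x ∈ G.graph.kids (G.graph.par a z) z := hG.mem_kids_par.2 ⟨hax.symm, hpx⟩
    refine wins_of_par (r := (k + 3) * Nat.log 2 M + 1) hk hG hH (a := a) (a' := a') (z := x)
      (z' := x') (by simp) (by simp) hax hxa.symm (le_trans (by omega) hpow) ?_
    rw [hpx, hpx']
    have hxne : G.branchType k z x ≠ H.branchType k z' x' := by
      intro h
      have := kidCount_pos (k := k) hxk
      rw [h] at this
      omega
    refine (wins_of_forall_branchWins hM (SimpleGraph.mem_kids.1 hxk).1 hadj' hxne
      (.inl (hsmall x hxk ?_))).mono (by omega) (by simp)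
    rintro rfl
    omega

end ColoredGraph

/-! ### Induction on the size of a type, and the opening at a centroid -/

namespace ColoredGraph

variable {C V W : Type*} [Fintype V] [Fintype W] {k r : ℕ} {G : ColoredGraph C V}
  {H : ColoredGraph C W} {L : List (V × W)}

/-- The case in which the type of the branch at `w` is a single vertex. -/
theorem wins_of_size_eq_one (hk : 3 ≤ k) (hG : G.IsTree) (hH : H.IsTree) {b w : V} {b' w' : W}
    (hb : G.graph.Adj b w) (hb' : H.graph.Adj b' w')
    (hne : G.branchType k b w ≠ H.branchType k b' w') (hs : (G.branchType k b w).size = 1) :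
    Wins k G H 1 [(b, b'), (w, w')] := by
  have := hG.nonempty
  have hkids : ∀ x, x ∉ G.graph.kids b w := by
    intro x hx
    have h1 := size_branchType_lt hG (by omega : 0 < k) (.inl hb) hx
    have h2 := (G.branchType k w x).size_pos
    omega
  by_cases hc : G.color w = H.color w'
  swap
  · exact .of_color (x := w) (x' := w') (by simp) hc
  obtain ⟨x', hx'⟩ : ∃ x', x' ∈ H.graph.kids b' w' := by
    by_contra! hcon
    refine hne ((branchType_eq_iff hG hH (.inl hb) (.inl hb')).2 ⟨hc, fun σ => ?_⟩)
    rw [kidCount, kidCount, Finset.eq_empty_of_forall_notMem hkids,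
      Finset.eq_empty_of_forall_notMem hcon]
    simp
  rw [SimpleGraph.mem_kids] at hx'
  refine Wins.step' (by simp; omega) x' fun x => ?_
  by_cases hadj : G.graph.Adj w x
  · have hxb : x = b := by
      by_contra h
      exact hkids x (SimpleGraph.mem_kids.2 ⟨hadj, h⟩)
    exact .of_eq (x := x) (x' := x') (y := b) (y' := b') (by simp) (by simp) (by simp [hxb, hx'.2])
  · exact .of_adj (x := w) (x' := w') (y := x) (y' := x') (by simp) (by simp)
      (by simp [hadj, hx'.1])

theorem wins_of_size_eq (hk : 3 ≤ k) (hG : G.IsTree) (hH : H.IsTree)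
    (hno : ∀ z z', G.branchType k z z ≠ H.branchType k z' z') {m : ℕ}
    (ih : ∀ n < m, BranchWins k G H n) {b w : V} {b' w' : W}
    (hb : G.graph.Adj b w) (hb' : H.graph.Adj b' w')
    (hne : G.branchType k b w ≠ H.branchType k b' w') (hs : (G.branchType k b w).size = m) :
    Wins k G H ((k + 3) * Nat.log 2 m + 1) [(b, b'), (w, w')] := by
  classical
  have hm := (G.branchType k b w).size_pos
  rw [hs] at hm
  by_cases hm1 : m = 1
  · subst hm1
    simpa using wins_of_size_eq_one hk hG hH hb hb' hne hs
  have := hH.nonempty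
  have hlog : Nat.log 2 m = Nat.log 2 (m / 2) + 1 := by
    rw [Nat.log_div_base]
    have : 0 < Nat.log 2 m := Nat.log_pos Nat.one_lt_two (by omega)
    omega
  -- The candidates lie beyond `w` and have more than half of the type size; `w` is one of them. The
  -- children of a deepest candidate are no longer candidates.
  let s : Finset V := {c | c ≠ b ∧ G.graph.par c b = w ∧
    m < 2 * (G.branchType k (G.graph.par b c) c).size}
  have hs0 : s.Nonempty := ⟨w, by
    simp only [s, Finset.mem_filter, Finset.mem_univ, true_and]
    refine ⟨hb.ne', hG.par_of_adj hb.symm, ?_⟩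
    rw [hG.par_of_adj hb, hs]
    omega⟩
  obtain ⟨c, hcs, hmax⟩ := s.exists_max_image (G.graph.dist b) hs0
  simp only [s, Finset.mem_filter, Finset.mem_univ, true_and] at hcs hmax
  obtain ⟨hcb, hcw, hcm⟩ := hcs
  have hpath := size_add_dist_le' hG (by omega : 0 < k) hcb.symm
  rw [hcw, hs] at hpath
  have hbc := hG.dist_pos hcb.symm
  have hwc : G.graph.dist w c + 1 = G.graph.dist b c := by
    have := hG.dist_par hcb
    rwa [hcw, SimpleGraph.dist_comm, SimpleGraph.dist_comm (u := c)] at this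
  set R := (k + 3) * Nat.log 2 (m / 2) + 1 with hR
  -- One halving pays for `k + 3` rounds: the pebble on `c`, one step of the search along the path,
  -- and `k + 1` rounds at the vertex where the types change.
  have hRm : (k + 3) * Nat.log 2 m = R + k + 2 := by
    rw [hlog, hR, mul_add]; omega
  rw [hRm]
  have hpow : m / 2 < 2 ^ R := lt_two_pow_mul_log (m / 2) (by omega)
  have hpow2 : 2 ^ R ≤ 2 ^ (R + k + 2) := Nat.pow_le_pow_right (by omega) (by omega)
  refine Wins.step (by simp; omega) c fun c' => ?_
  by_cases hd : G.graph.dist b c = H.graph.dist b' c'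
  swap
  · exact wins_of_dist_ne hk hG hH (x := b) (x' := b') (y := c) (y' := c') (by simp) (by simp)
      (le_trans (by omega) hpow2) hd
  by_cases hdw : G.graph.dist w c = H.graph.dist w' c'
  swap
  · exact wins_of_dist_ne hk hG hH (x := w) (x' := w') (y := c) (y' := c') (by simp) (by simp)
      (le_trans (by omega) hpow2) hdw
  have hcb' : b' ≠ c' := by rintro rfl; rw [SimpleGraph.dist_self] at hd; omega
  have hcw' : w' = H.graph.par c' b' :=
    hH.eq_par hb'.symm (by rw [SimpleGraph.dist_comm, SimpleGraph.dist_comm (u := c')]; omega)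
  by_cases htc : G.branchType k (G.graph.par b c) c = H.branchType k (H.graph.par b' c') c'
  · have := wins_of_segment hk hG hH hno (m / 2) (fun n hn => ih n (by omega)) hcb.symm hd
      (by rwa [hcw, ← hcw']) htc (by rw [hcw, hs]; omega)
    refine this.mono (by omega) (by intro q; simp only [List.mem_cons]; tauto)
  · have hkid : ∀ x ∈ G.graph.kids (G.graph.par b c) c, (G.branchType k c x).size ≤ m / 2 := by
      intro x hx
      have hx' := hG.mem_kids_par.1 hx
      have hbx := hG.dist_par hx'.1.symm
      rw [hx'.2] at hbx
      by_contra hcon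
      have hbet : G.graph.dist b c + G.graph.dist c x = G.graph.dist b x := by
        rw [SimpleGraph.dist_eq_one_iff_adj.2 (SimpleGraph.mem_kids.1 hx).1, hbx]
      have := hmax x ⟨hx'.1, by rw [← hG.par_eq_of_dist' hbet hcb, hcw], by rw [hx'.2]; omega⟩
      omega
    exact (wins_of_branchType_ne_at (r := R) hk hG hH hno (a := b) (a' := b') (z := c) (z' := c')
      (by simp) (by simp) hcb.symm hd (by omega) htc (fun σ => σ.size ≤ m / 2)
      (fun x x' hx hx' hne hs =>
        wins_of_forall_branchWins (fun n hn => ih n (by omega)) hx hx' hne hs)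
      (G.graph.par b c) (fun x hx _ => hkid x hx) (fun h => .inl (hkid _ h))
      fun x' _ _ => .inl hkid).mono (by omega) (List.Subset.refl _)

theorem branchWins (hk : 3 ≤ k) (hG : G.IsTree) (hH : H.IsTree)
    (hno : ∀ z z', G.branchType k z z ≠ H.branchType k z' z') (m : ℕ) : BranchWins k G H m := by
  induction m using Nat.strong_induction_on with
  | _ m ih =>
    rintro b w b' w' hb hb' hne (hs | hs)
    · exact wins_of_size_eq hk hG hH hno ih hb hb' hne hs
    · exact (wins_of_size_eq hk hH hG (fun z z' => (hno z' z).symm) (fun n hn => (ih n hn).symm)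
        hb' hb hne.symm hs).swap

/-- If one side has at most `k - 2` neighbors of type `σ`, the centroid halves `n` and one round is
saved. Otherwise `σ` repeats at `z`, so its size is strictly below `n / 2` and `n - 1` replaces `n`.
Either saving makes the final bound strict. -/
theorem wins_nil (hk : 3 ≤ k) (hG : G.IsTree) (hH : H.IsTree)
    (hno : ∀ z z', G.branchType k z z ≠ H.branchType k z' z') (hn : 2 ≤ Fintype.card V) :
    Wins k G H (max ((k + 3) * Nat.log 2 (Fintype.card V) - 1)
      ((k + 3) * Nat.log 2 (Fintype.card V - 1))) [] := by
  set n := Fintype.card V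
  have := hH.nonempty
  obtain ⟨z, hz⟩ := hG.exists_centroid
  have hmax : ∃ s, s + 1 = max ((k + 3) * Nat.log 2 n - 1) ((k + 3) * Nat.log 2 (n - 1)) := by
    have : 0 < Nat.log 2 n := Nat.log_pos Nat.one_lt_two hn
    have h2 : k + 3 ≤ (k + 3) * Nat.log 2 n := Nat.le_mul_of_pos_right _ this
    exact ⟨_, Nat.sub_add_cancel (le_max_of_le_left (by omega))⟩
  obtain ⟨s, hs⟩ := hmax
  rw [← hs]
  refine Wins.step (by simp; omega) z fun z' => ?_
  by_cases hc : G.color z = H.color z'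
  swap
  · exact .of_color (x := z) (x' := z') (by simp) hc
  obtain ⟨σ, hσ⟩ : ∃ σ, min k (G.kidCount k z z σ) ≠ min k (H.kidCount k z' z' σ) := by
    by_contra! h
    exact hno z z' ((branchType_eq_iff hG hH (.inr rfl) (.inr rfl)).2 ⟨hc, h⟩)
  have key : ∀ m, (∀ x x', G.graph.Adj z x → H.graph.Adj z' x' →
      (G.branchType k z x = σ ∨ H.branchType k z' x' = σ) →
      G.branchType k z x ≠ H.branchType k z' x' → (G.branchType k z x).size ≤ m ∨
        (H.branchType k z' x').size ≤ m) →
      Wins k G H ((k + 3) * Nat.log 2 m + 1 +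
        min (G.kidCount k z z σ) (H.kidCount k z' z' σ) + 2) [(z, z')] := by
    intro m hm
    have hw : ∀ x x', G.graph.Adj z x → H.graph.Adj z' x' →
        (G.branchType k z x = σ ∨ H.branchType k z' x' = σ) →
        G.branchType k z x ≠ H.branchType k z' x' →
        Wins k G H ((k + 3) * Nat.log 2 m + 1) [(z, z'), (x, x')] :=
      fun x x' hx hx' hxσ hne => wins_of_forall_branchWins
        (fun n _ => branchWins hk hG hH hno n) hx hx' hne (hm x x' hx hx' hxσ hne)
    rcases Nat.lt_or_gt_of_ne (show G.kidCount k z z σ ≠ H.kidCount k z' z' σ from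
      fun e => hσ (by rw [e])) with hlt | hlt
    · rw [min_eq_left hlt.le]
      exact wins_of_kidCount_self_lt hk hG hH hlt (by omega) fun x hx x' hx' hxσ hxσ' =>
        hw x x' hx hx' (.inr hxσ') (by rwa [hxσ'])
    · rw [min_eq_right hlt.le]
      refine .of_swap <| wins_of_kidCount_self_lt hk hH hG hlt (by omega)
        fun x hx x' hx' hxσ hxσ' => (hw x' x hx' hx (.inl hxσ') ?_).swap
      rw [hxσ']; exact hxσ.symm
  by_cases hcase : min (G.kidCount k z z σ) (H.kidCount k z' z' σ) + 2 ≤ k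
  · refine (key (n / 2) fun x x' hx _ _ _ => .inl ?_).mono ?_ (List.Subset.refl _)
    · have h1 := size_branchType_le (k := k) hG hx
      have h2 := hz x hx
      omega
    · have hlog : Nat.log 2 n = Nat.log 2 (n / 2) + 1 := by
        rw [Nat.log_div_base]
        have : 0 < Nat.log 2 n := Nat.log_pos Nat.one_lt_two hn
        omega
      have := le_max_left ((k + 3) * Nat.log 2 n - 1) ((k + 3) * Nat.log 2 (n - 1))
      rw [← hs, hlog, mul_add] at this
      omega
  · have hsz := two_mul_size_lt hG (k := k) (z := z) (σ := σ) (by omega)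
    have hpos := σ.size_pos
    refine (key ((n - 1) / 2) fun x x' _ _ hxσ _ => hxσ.imp ?_ ?_).mono ?_ (List.Subset.refl _)
    · rintro h; rw [h]; omega
    · rintro h; rw [h]; omega
    · have hlog : Nat.log 2 (n - 1) = Nat.log 2 ((n - 1) / 2) + 1 := by
        rw [Nat.log_div_base]
        have : 0 < Nat.log 2 (n - 1) := Nat.log_pos Nat.one_lt_two (by omega)
        omega
      have := le_max_right ((k + 3) * Nat.log 2 n - 1) ((k + 3) * Nat.log 2 (n - 1))
      rw [← hs, hlog, mul_add] at this
      omega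

end ColoredGraph

/-! ### The logarithmic bounds -/

theorem exists_distinguishes_of_distDepth_lt_top {k : ℕ} {C V W : Type*} {G : ColoredGraph C V}
    {H : ColoredGraph C W} (h : distDepth k G H < ⊤) : ∃ φ : FOk C k, φ.Distinguishes G H := by
  by_contra! hcon
  simp [distDepth, hcon] at h

theorem exists_distDepth_eq {k : ℕ} (hk : 3 ≤ k) {C V W : Type*} [Finite V] [Finite W]
    {G : ColoredGraph C V} {H : ColoredGraph C W} (hG : G.IsTree) (hH : H.IsTree)
    (hn : 2 ≤ Nat.card V) (h : ∃ φ : FOk C k, φ.Distinguishes G H) :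
    ∃ r : ℕ, distDepth k G H = (r : ℕ∞) ∧
      (r : ℝ) < ((k : ℝ) + 3) * Real.logb 2 (Nat.card V : ℝ) := by
  have := Fintype.ofFinite V
  have := Fintype.ofFinite W
  have := hG.nonempty
  have := hH.nonempty
  obtain ⟨φ, hφ⟩ := h
  rw [Nat.card_eq_fintype_card] at hn ⊢
  have hw := (ColoredGraph.wins_nil hk hG hH
    (fun z z' e => ColoredGraph.not_distinguishes hG hH e φ hφ) hn).distDepth_le
  set n := Fintype.card V
  obtain ⟨r, hr⟩ := ENat.ne_top_iff_exists.1 (ne_top_of_le_ne_top (ENat.natCast_ne_top _) hw)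
  refine ⟨r, hr.symm, ?_⟩
  rw [← hr] at hw
  have hw' : r ≤ max ((k + 3) * Nat.log 2 n - 1) ((k + 3) * Nat.log 2 (n - 1)) := by
    exact_mod_cast hw
  have hlog : ∀ m : ℕ, (Nat.log 2 m : ℝ) ≤ Real.logb 2 m := fun m => by
    exact_mod_cast Real.natLog_le_logb m 2
  have hk0 : (0 : ℝ) < (k : ℝ) + 3 := by positivity
  rcases le_max_iff.1 hw' with h1 | h1
  · have h2 : 0 < Nat.log 2 n := Nat.log_pos Nat.one_lt_two hn
    have h3 : r < (k + 3) * Nat.log 2 n := by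
      have := Nat.mul_pos (show 0 < k + 3 by omega) h2
      omega
    have h4 : (r : ℝ) < ((k : ℝ) + 3) * Nat.log 2 n := by exact_mod_cast h3
    exact h4.trans_le (mul_le_mul_of_nonneg_left (hlog n) hk0.le)
  · have h4 : (r : ℝ) ≤ ((k : ℝ) + 3) * Nat.log 2 (n - 1) := by exact_mod_cast h1
    refine h4.trans_lt (mul_lt_mul_of_pos_left ((hlog _).trans_lt ?_) hk0)
    refine Real.logb_lt_logb one_lt_two ?_ ?_
    · exact_mod_cast (by omega : 0 < n - 1)
    · exact_mod_cast (by omega : n - 1 < n)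

theorem exists_treeAltFun_eq {k : ℕ} (hk : 3 ≤ k) {n : ℕ} (hn : 2 ≤ n) :
    ∃ a : ℕ, treeAltFun.{u, v, w} k n = (a : ℕ∞) ∧
      (a : ℝ) < ((k : ℝ) + 3) * Real.logb 2 (n : ℝ) := by
  set x := ((k : ℝ) + 3) * Real.logb 2 (n : ℝ)
  have hx : 0 < x := mul_pos (by positivity) (Real.logb_pos one_lt_two (by exact_mod_cast hn))
  -- Strict bounds need not survive a supremum, but the values are integers, so the ceiling minus
  -- one bounds all of them.
  have hle : treeAltFun.{u, v, w} k n ≤ ((⌈x⌉₊ - 1 : ℕ) : ℕ∞) := by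
    refine sSup_le ?_
    rintro a ⟨C, V, W, T, T', _, _, hV, -, hT, hT', hφ, rfl⟩
    obtain ⟨r, hr, hrx⟩ := exists_distDepth_eq hk hT hT' (hV ▸ hn) hφ
    refine (distAlt_le_distDepth k T T').trans (hr.trans_le ?_)
    rw [hV] at hrx
    have := Nat.lt_ceil.2 hrx
    exact Nat.cast_le.2 (Nat.le_sub_one_of_lt this)
  obtain ⟨a, ha⟩ := ENat.ne_top_iff_exists.1 (ne_top_of_le_ne_top (ENat.natCast_ne_top _) hle)
  refine ⟨a, ha.symm, Nat.lt_ceil.1 ?_⟩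
  rw [← ha] at hle
  have h1 : a ≤ ⌈x⌉₊ - 1 := by exact_mod_cast hle
  have := Nat.ceil_pos.2 hx
  omega

theorem theorem3 (k : ℕ) (hk : 3 ≤ k) :
    (∀ (C : Type u) (V : Type v) (V' : Type w) [Finite V] [Finite V']
        (T : ColoredGraph C V) (T' : ColoredGraph C V'),
        T.IsTree → T'.IsTree → 2 ≤ Nat.card V → distDepth k T T' < ⊤ →
        ∃ r : ℕ, distDepth k T T' = (r : ℕ∞) ∧
          (r : ℝ) < ((k : ℝ) + 3) * Real.logb 2 (Nat.card V : ℝ)) ∧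
    (∀ n : ℕ, 2 ≤ n →
        ∃ a : ℕ, treeAltFun.{u, v, w} k n = (a : ℕ∞) ∧
          (a : ℝ) < ((k : ℝ) + 3) * Real.logb 2 (n : ℝ)) ∧
    (fun n : ℕ => ((treeAltFun.{u, v, w} k n).toNat : ℝ))
      =O[Filter.atTop] (fun n : ℕ => Real.log (n : ℝ)) := by
  refine ⟨fun C V V' _ _ T T' hT hT' hn h => exists_distDepth_eq hk hT hT' hn
    (exists_distinguishes_of_distDepth_lt_top h), fun n hn => exists_treeAltFun_eq hk hn, ?_⟩
  refine Asymptotics.IsBigO.of_bound (((k : ℝ) + 3) / Real.log 2) ?_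
  filter_upwards [Filter.eventually_ge_atTop 2] with n hn
  obtain ⟨a, ha, hax⟩ := exists_treeAltFun_eq.{u, v, w} hk hn
  have hlog : 0 ≤ Real.log n := Real.log_natCast_nonneg n
  rw [ha, ENat.toNat_natCast, Real.norm_of_nonneg (Nat.cast_nonneg a), Real.norm_of_nonneg hlog]
  refine hax.le.trans (le_of_eq ?_)
  rw [Real.logb]
  ring
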